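/- Fix integers $d\ge 1$ and $n\ge 1$. Let $\mathbb Z_n^d$ be the discrete torus with its nearest-neighbour graph and let $E(\mathbb Z_n^d)$ be its edge set. In dynamical percolation with parameters $p\in[0,1]$ and $\mu>0$, started from $\eta_0\in\{0,1\}^{E(\mathbb Z_n^d)}$, the edges evolve independently; a closed edge (state $0$) becomes open (state $1$) at rate $p\mu$, and an open edge becomes closed at rate $(1-p)\mu$. Write $\mathcal P_{\eta_0}$ for the law of the resulting path $\eta=(\eta_t)_{t\ge 0}$. Given $\eta$, a walker $(X_t)_{t\ge0}$ started from $x$, at rate $1$, chooses a uniformly random neighbour of its current position and moves there if and only if the connecting edge is open at that time. Write $\mathbb E_{x,\eta}$ for the quenched expectation (the environment path $\eta$ is fixed) and $\mathbb E_{x,\eta_0}$ for the annealed expectation (only the initial configuration $\eta_0$ is fixed). For $A\subseteq\mathbb Z_n^d$ let $\tau_A=\inf\{t\ge0: X_t\in A\}$. **Theorem.** For every $d\ge1$ and $\delta>0$ there is a constant $C=C(d,\delta)<\infty$ such that for all $p\in[\delta,1]$, all $n\ge 1$, all $0<\mu\le 1/2$, all $\varepsilon>0$ and all $A\subseteq\mathbb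 Z_n^d$ with $|A|\ge n^d/2$, $$\max_{\eta_0}\ \mathcal P_{\eta_0}\Big(\eta:\ \max_{x}\mathbb E_{x,\eta}[\tau_A]\ \ge\ \frac{C\,n^2\log(n/\varepsilon)}{\mu}\Big)\ \le\ \varepsilon \qquad\text{and}\qquad \max_{x,\eta_0}\ \mathbb E_{x,\eta_0}[\tau_A]\ \le\ \frac{C\,n^2}{\mu}.$$ -/

import Mathlib

open MeasureTheory ProbabilityTheory
open scoped ENNReal NNReal

namespace DynamicalPercolation

/-! ### The torus -/

/-- The vertex set of the discrete torus `ℤ_n^d`. -/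
abbrev Vertex (n d : ℕ) : Type := Fin d → ZMod n

/-- The nearest-neighbour graph on the torus: `x` and `y` are adjacent iff they are distinct and
differ by `± 1` (mod `n`) in exactly one coordinate. -/
def torus (n d : ℕ) : SimpleGraph (Vertex n d) :=
  SimpleGraph.fromRel fun x y => ∃ i : Fin d, y = x + Pi.single i 1

/-- Edges of the torus. -/
abbrev Edge (n d : ℕ) : Type := (torus n d).edgeSet

/-- A configuration declares every edge open (`true`) or closed (`false`). -/
abbrev Config (n d : ℕ) : Type := Edge n d → Bool

/-- The pair `x, y` is joined by an edge of the torus that is open in `ζ`. -/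
def IsOpen {n d : ℕ} (ζ : Config n d) (x y : Vertex n d) : Prop :=
  ∃ h : s(x, y) ∈ (torus n d).edgeSet, ζ ⟨s(x, y), h⟩ = true

/-- The `2 d` directions `± e_i`. -/
abbrev Direction (d : ℕ) : Type := Fin d × Bool

/-- The endpoint of the step from `x` in a given direction. For `n ≥ 2` and a uniform direction
this is a uniformly chosen neighbour of `x`. -/
def neighbour {n d : ℕ} (x : Vertex n d) (v : Direction d) : Vertex n d :=
  x + Pi.single v.1 (if v.2 then 1 else -1)

/-! ### Marked Poisson clocks -/

/-- A realisation of a marked clock: the `k`-th entry holds the waiting time between ring number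
`k` and the previous ring (or time `0`), and the mark of ring number `k`. -/
abbrev Clock (M : Type) : Type := ℕ → ℝ × M

/-- The law of a Poisson clock of rate `r` with i.i.d. marks of law `ν`: the waiting times are
i.i.d. exponential of rate `r`, the marks are i.i.d. of law `ν`, and both are independent. -/
noncomputable def clockLaw {M : Type} [MeasurableSpace M] (r : ℝ) (ν : Measure M) :
    Measure (Clock M) :=
  Measure.infinitePi fun _ : ℕ => (expMeasure r).prod ν

/-- The time of ring number `k` (rings are numbered from `0`). -/
noncomputable def ringTime {M : Type} (c : Clock M) (k : ℕ) : ℝ :=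
  ∑ i ∈ Finset.range (k + 1), (c i).1

/-- The number of rings in `[0, t]` (almost surely finite). -/
noncomputable def ringCount {M : Type} (c : Clock M) (t : ℝ≥0) : ℕ :=
  Set.ncard {k : ℕ | ringTime c k ≤ t}

/-! ### The environment -/

/-- The randomness of the environment: independent clocks of rate `μ` on the edges, whose rings
are independently opening signals (`true`) with probability `p` and closing signals (`false`) with
probability `1 - p`. So opening signals arrive at rate `p μ` and, independently of them, closing
signals at rate `(1 - p) μ`. -/
noncomputable def envNoise (n d : ℕ) (p : unitInterval) (μ : ℝ) :
    Measure (Edge n d → Clock Bool) :=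
  Measure.infinitePi fun _ : Edge n d => clockLaw μ (bernoulliMeasure true false p)

/-- The state of an edge with initial state `b` after the first `k` signals. -/
def stateAfter (b : Bool) (c : Clock Bool) : ℕ → Bool
  | 0 => b
  | k + 1 => (c k).2

/-- Dynamical percolation `(η_t)_{t ≥ 0}` started from `η₀`: an edge opens at opening signals and
closes at closing signals. Under `envNoise n d p μ` the edges evolve independently, a closed edge
switches to open at rate `p μ` and an open edge switches to closed at rate `(1 - p) μ`. -/
noncomputable def environment {n d : ℕ} (η₀ : Config n d) (ω : Edge n d → Clock Bool) :
    ℝ≥0 → Config n d :=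
  fun t e => stateAfter (η₀ e) (ω e) (ringCount (ω e) t)

/-! ### The walk -/

/-- The randomness of the walker: a clock of rate `1`, with a uniform direction at every ring. -/
noncomputable def walkNoise (d : ℕ) : Measure (Clock (Direction d)) :=
  clockLaw 1 (uniformOn (Set.univ : Set (Direction d)))

open Classical in
/-- The position, after the first `k` rings, of the walker started from `x` in the (fixed)
environment `η`: at each ring it moves along the chosen direction if and only if the edge in
question is open at that time. -/
noncomputable def positionAfter {n d : ℕ} (η : ℝ≥0 → Config n d) (x : Vertex n d)
    (c : Clock (Direction d)) : ℕ → Vertex n d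
  | 0 => x
  | k + 1 =>
    if IsOpen (η (ringTime c k).toNNReal) (positionAfter η x c k)
        (neighbour (positionAfter η x c k) (c k).2)
    then neighbour (positionAfter η x c k) (c k).2
    else positionAfter η x c k

/-- The walk `(X_t)_{t ≥ 0}` started from `x` in the environment `η`. -/
noncomputable def walk {n d : ℕ} (η : ℝ≥0 → Config n d) (x : Vertex n d)
    (c : Clock (Direction d)) : ℝ≥0 → Vertex n d :=
  fun t => positionAfter η x c (ringCount c t)

/-- The hitting time `τ_A = inf {t ≥ 0 : X_t ∈ A}` of a path, equal to `∞` if `A` is never hit. -/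
noncomputable def hittingTime {V : Type} (A : Set V) (X : ℝ≥0 → V) : ℝ≥0∞ :=
  ⨅ (t : ℝ≥0) (_ : X t ∈ A), (t : ℝ≥0∞)

/-- The quenched expectation `E_{x,η}[τ_A]`: the environment path `η` is fixed and only the
walker's randomness is averaged. -/
noncomputable def quenchedHitting {n d : ℕ} (A : Set (Vertex n d)) (x : Vertex n d)
    (η : ℝ≥0 → Config n d) : ℝ≥0∞ :=
  ∫⁻ c, hittingTime A (walk η x c) ∂(walkNoise d)

/-- The annealed expectation `E_{x,η₀}[τ_A]` under the law of the full system, in which the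
environment's and the walker's sources of randomness are independent. -/
noncomputable def annealedHitting {n d : ℕ} (p : unitInterval) (μ : ℝ) (A : Set (Vertex n d))
    (x : Vertex n d) (η₀ : Config n d) : ℝ≥0∞ :=
  ∫⁻ ω, hittingTime A (walk (environment η₀ ω.1) x ω.2) ∂((envNoise n d p μ).prod (walkNoise d))

/-! ### The laws above are probability measures -/

theorem isProbabilityMeasure_clockLaw {M : Type} [MeasurableSpace M] {r : ℝ} (hr : 0 < r)
    (ν : Measure M) [IsProbabilityMeasure ν] : IsProbabilityMeasure (clockLaw r ν) := by
  have := isProbabilityMeasure_expMeasure hr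
  unfold clockLaw
  infer_instance

theorem isProbabilityMeasure_envNoise (n d : ℕ) (p : unitInterval) {μ : ℝ} (hμ : 0 < μ) :
    IsProbabilityMeasure (envNoise n d p μ) := by
  have := isProbabilityMeasure_clockLaw hμ (bernoulliMeasure true false p)
  unfold envNoise
  infer_instance

theorem isProbabilityMeasure_walkNoise (d : ℕ) [NeZero d] :
    IsProbabilityMeasure (walkNoise d) :=
  isProbabilityMeasure_clockLaw one_pos _

end DynamicalPercolation

/-! The proof is an $\ell^2$ energy argument for the walk killed on $A$. For a fixed environment and
fixed waiting times, let $u_k$ be the sub-probability weight of the killed walk after $k$ rings. The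
expected hitting time is at most the sum over $k$ of the survival probabilities, because each
waiting time has mean one and is independent of survival up to then
(`quenchedHitting_le_tsum_weight`). The rate $1$ walk is then replaced by the lazy rate $2$ walk,
which has the same law up to extra idle rings; twice as many rings are counted, whence the factor
$1/2$ in `quenchedHitting_le`.

In a frozen configuration a step of the walk is reversible for counting measure, so a lazy step
lowers $\|u\|_2^2$ by at least $(8d)^{-1}$ times the squared gradient of $u$ over the open edges
(`dissipation`). The weight $u_k$ depends only on the environment up to the $k$-th ring. Given that
past, an edge opened by a signal that arrives before the next ring, with no further signal, is open
at that ring; averaged over the waiting time this has probability at least $\delta\mu/4$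
(`lintegral_open_environment`, `lintegral_opening_expMeasure`). Hence the mean square loses at least
$\delta\mu/(32d)$ times the mean of the full Dirichlet energy at every ring, whatever the initial
configuration (`meanSq_succ_add_le`).

Two functional inequalities finish the decay. A Poincaré inequality, valid because $u_k$ vanishes on
half of the torus, gives geometric decay at rate $\theta=\delta\mu/(32d^2n^2)$. A Nash inequality,
written at each scale $r\le n$ as a linear bound so that it can be averaged over the randomness,
brings the mean square down to $4n^{-d}$ within order $n^2/\mu$ rings (`exists_le_of_multiscale`).
Cauchy–Schwarz turns mean squares into survival probabilities.

For the annealed bound the survival probabilities are summed: order $n^2/\mu$ rings to reach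
$4n^{-d}$, then a geometric series of ratio $1-\theta/2$, so no logarithm appears. For the quenched
bound one waits $J\approx 4d\log(n/\varepsilon)/\theta$ rings; by then the expected tail, summed
over all starting points, is at most $2\varepsilon/\theta$, and Markov's inequality controls all
starting points at once. -/

namespace DynamicalPercolation

/-! ### Resampling a coordinate of a product measure -/

theorem measurable_update_pair {ι : Type*} [DecidableEq ι] {X : ι → Type*}
    [∀ i, MeasurableSpace (X i)] (m : ι) :
    Measurable fun z : (∀ i, X i) × X m => Function.update z.1 m z.2 := by
  refine measurable_pi_iff.2 fun i => ?_
  by_cases h : i = m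
  · subst h; simpa using measurable_snd
  · simp only [Function.update_of_ne h]; fun_prop

theorem infinitePi_map_update {ι : Type*} [DecidableEq ι] {X : ι → Type*}
    [∀ i, MeasurableSpace (X i)] (ν : ∀ i, Measure (X i)) [∀ i, IsProbabilityMeasure (ν i)]
    (m : ι) :
    ((Measure.infinitePi ν).prod (ν m)).map (fun z => Function.update z.1 m z.2) =
      Measure.infinitePi ν := by
  refine Measure.eq_infinitePi ν fun s t ht => ?_
  have hms : MeasurableSet (Set.pi (s : Set ι) t) :=
    MeasurableSet.pi s.countable_toSet fun i _ => ht i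
  rw [Measure.map_apply (measurable_update_pair m) hms]
  by_cases hm : m ∈ s
  · have : (fun z : (∀ i, X i) × X m => Function.update z.1 m z.2) ⁻¹' Set.pi (s : Set ι) t =
        Set.pi ((s.erase m : Finset ι) : Set ι) t ×ˢ t m := by
      ext z
      simp only [Set.mem_preimage, Set.mem_pi, Finset.mem_coe, Set.mem_prod, Finset.mem_erase]
      constructor
      · refine fun h => ⟨fun i hi => ?_, ?_⟩
        · simpa [Function.update_of_ne hi.1] using h i hi.2
        · simpa using h m hm
      · rintro ⟨h1, h2⟩ i hi
        by_cases h : i = m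
        · subst h; simpa using h2
        · simpa [Function.update_of_ne h] using h1 i ⟨h, hi⟩
    rw [this, Measure.prod_prod, Measure.infinitePi_pi _ (fun i _ => ht i),
      Finset.prod_erase_mul _ _ hm]
  · have : (fun z : (∀ i, X i) × X m => Function.update z.1 m z.2) ⁻¹' Set.pi (s : Set ι) t =
        Set.pi (s : Set ι) t ×ˢ Set.univ := by
      ext z
      simp only [Set.mem_preimage, Set.mem_pi, Finset.mem_coe, Set.mem_prod, Set.mem_univ,
        and_true]
      refine forall₂_congr fun i hi => ?_
      rw [Function.update_of_ne (ne_of_mem_of_not_mem hi hm)]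
    rw [this, Measure.prod_prod, Measure.infinitePi_pi _ (fun i _ => ht i), measure_univ, mul_one]

/-- The form in which independence is used below: redraw one coordinate and freeze all the others.
It replaces conditional expectations given the past of a clock. -/
theorem lintegral_infinitePi_update {ι : Type*} [DecidableEq ι] {X : ι → Type*}
    [∀ i, MeasurableSpace (X i)] (ν : ∀ i, Measure (X i)) [∀ i, IsProbabilityMeasure (ν i)]
    (m : ι) {f : (∀ i, X i) → ℝ≥0∞} (hf : Measurable f) :
    ∫⁻ c, f c ∂Measure.infinitePi ν =
      ∫⁻ c, ∫⁻ y, f (Function.update c m y) ∂ν m ∂Measure.infinitePi ν := by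
  conv_lhs => rw [← infinitePi_map_update ν m, lintegral_map hf (measurable_update_pair m)]
  exact lintegral_prod _ (hf.comp (measurable_update_pair m)).aemeasurable

/-! ### Exponential waiting times -/

theorem measurable_exponentialPDF (r : ℝ) : Measurable (exponentialPDF r) :=
  (measurable_exponentialPDFReal r).ennreal_ofReal

theorem lintegral_expMeasure (r : ℝ) {f : ℝ → ℝ≥0∞} (hf : Measurable f) :
    ∫⁻ x, f x ∂expMeasure r = ∫⁻ x, exponentialPDF r x * f x := by
  have : expMeasure r = volume.withDensity (exponentialPDF r) := rfl
  rw [this, lintegral_withDensity_eq_lintegral_mul _ (measurable_exponentialPDF r) hf]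
  rfl

theorem ae_expMeasure_pos (r : ℝ) : ∀ᵐ x ∂expMeasure r, 0 < x := by
  have : expMeasure r = volume.withDensity (exponentialPDF r) := rfl
  rw [this, ae_withDensity_iff (measurable_exponentialPDF r)]
  filter_upwards [Measure.ae_ne volume (0 : ℝ)] with x hx h
  by_contra! h'
  exact h (exponentialPDF_of_neg (lt_of_le_of_ne h' hx))

theorem expMeasure_Ioi {r : ℝ} (hr : 0 < r) {x : ℝ} (hx : 0 ≤ x) :
    expMeasure r (Set.Ioi x) = ENNReal.ofReal (Real.exp (-(r * x))) := by
  have := isProbabilityMeasure_expMeasure hr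
  have h1 := cdf_expMeasure_eq hr x
  rw [if_pos hx, cdf_eq_real] at h1
  have h2 : (expMeasure r).real (Set.Ioi x) = Real.exp (-(r * x)) := by
    rw [← Set.compl_Iic, probReal_compl_eq_one_sub measurableSet_Iic, h1]; ring
  rw [← h2, ofReal_measureReal]

theorem lintegral_exp_neg_expMeasure {r a : ℝ} (hr : 0 < r) (ha : 0 ≤ a) :
    ∫⁻ x, ENNReal.ofReal (Real.exp (-(a * x))) ∂expMeasure r = ENNReal.ofReal (r / (r + a)) := by
  rw [lintegral_expMeasure _ (by fun_prop)]
  have h : ∀ x, exponentialPDF r x * ENNReal.ofReal (Real.exp (-(a * x))) =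
      ENNReal.ofReal (r / (r + a)) * exponentialPDF (r + a) x := by
    intro x
    rw [exponentialPDF_eq, exponentialPDF_eq]
    split_ifs
    · rw [← ENNReal.ofReal_mul (by positivity), ← ENNReal.ofReal_mul (by positivity)]
      congr 1
      have : Real.exp (-((r + a) * x)) = Real.exp (-(r * x)) * Real.exp (-(a * x)) := by
        rw [← Real.exp_add]; ring_nf
      rw [this]
      field_simp
    · simp
  simp_rw [h]
  rw [lintegral_const_mul', lintegral_exponentialPDF_eq_one (by positivity), mul_one]
  exact ENNReal.ofReal_ne_top

theorem lintegral_id_expMeasure_one : ∫⁻ x, ENNReal.ofReal x ∂expMeasure 1 = 1 := by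
  -- The integrand $x e^{-x}$ is the Gamma density of shape $2$ and rate $1$.
  rw [lintegral_expMeasure _ (by fun_prop), ← lintegral_gammaPDF_eq_one (two_pos) (one_pos)]
  refine lintegral_congr fun x => ?_
  rw [exponentialPDF_eq, gammaPDF_eq]
  split_ifs with h
  · rw [← ENNReal.ofReal_mul (by positivity)]
    congr 1
    have h2 : Real.Gamma 2 = 1 := Real.Gamma_two
    norm_num [h2]
    ring
  · simp

/-- A rate `1` exponential time is a rate `2` exponential time which, with probability `1 / 2`, is
followed by an independent rate `1` exponential time. -/
theorem lintegral_expMeasure_one {f : ℝ → ℝ≥0∞} (hf : Measurable f) :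
    ∫⁻ x, f x ∂expMeasure 1 = 2⁻¹ * ∫⁻ x, f x ∂expMeasure 2 +
      2⁻¹ * ∫⁻ a, ∫⁻ b, f (a + b) ∂expMeasure 1 ∂expMeasure 2 := by
  have hpdf (r a : ℝ) : exponentialPDF 2 a * exponentialPDF 1 (r - a) =
      ENNReal.ofReal (2 * Real.exp (-r)) *
        (exponentialPDF 1 a * (Set.Iic r).indicator (fun _ => 1) a) := by
    simp only [exponentialPDF_eq, Set.indicator_apply, Set.mem_Iic, sub_nonneg]
    split_ifs
    · rw [← ENNReal.ofReal_mul (by positivity), mul_one, ← ENNReal.ofReal_mul (by positivity)]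
      congr 1
      have h1 : Real.exp (-(1 * (r - a))) = Real.exp (-r) * Real.exp a := by
        rw [← Real.exp_add]; ring_nf
      have h2 : Real.exp (-(1 * a)) = Real.exp (-(2 * a)) * Real.exp a := by
        rw [← Real.exp_add]; ring_nf
      rw [h1, h2]; ring
    all_goals simp
  have hinner (r : ℝ) : ∫⁻ a, exponentialPDF 2 a * exponentialPDF 1 (r - a) =
      ENNReal.ofReal (2 * Real.exp (-r)) * expMeasure 1 (Set.Iic r) := by
    simp_rw [hpdf]
    rw [lintegral_const_mul' _ _ ENNReal.ofReal_ne_top,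
      ← lintegral_expMeasure _ (measurable_const.indicator measurableSet_Iic),
      lintegral_indicator_const measurableSet_Iic, one_mul]
  -- At the level of densities the claim is $e^{-r}=e^{-2r}+e^{-r}(1-e^{-r})$, the last term being
  -- half of the convolution.
  have hsum (r : ℝ) : exponentialPDF 1 r = 2⁻¹ * exponentialPDF 2 r +
      2⁻¹ * ∫⁻ a, exponentialPDF 2 a * exponentialPDF 1 (r - a) := by
    have := isProbabilityMeasure_expMeasure one_pos
    have h2 : (2⁻¹ : ℝ≥0∞) = ENNReal.ofReal 2⁻¹ := by
      rw [ENNReal.ofReal_inv_of_pos two_pos]; simp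
    have h1 := cdf_expMeasure_eq one_pos r
    rw [cdf_eq_real] at h1
    rw [hinner, ← ofReal_measureReal, h1, exponentialPDF_eq, exponentialPDF_eq]
    split_ifs with hr
    · have h3 : 0 ≤ 1 - Real.exp (-(1 * r)) := by
        rw [sub_nonneg, Real.exp_le_one_iff]; linarith
      rw [h2, ← ENNReal.ofReal_mul (by positivity), ← ENNReal.ofReal_mul (by positivity),
        ← ENNReal.ofReal_mul (by positivity), ← ENNReal.ofReal_add (by positivity) (by positivity)]
      congr 1
      have h4 : Real.exp (-(2 * r)) = Real.exp (-(1 * r)) * Real.exp (-r) := by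
        rw [← Real.exp_add]; ring_nf
      rw [h4]; ring_nf
    · simp
  have hconv : ∫⁻ a, ∫⁻ b, f (a + b) ∂expMeasure 1 ∂expMeasure 2 =
      ∫⁻ r, (∫⁻ a, exponentialPDF 2 a * exponentialPDF 1 (r - a)) * f r := by
    have e1 (a : ℝ) : ∫⁻ b, f (a + b) ∂expMeasure 1 = ∫⁻ r, exponentialPDF 1 (r - a) * f r := by
      rw [lintegral_expMeasure _ (by fun_prop),
        ← lintegral_add_left_eq_self (fun r => exponentialPDF 1 (r - a) * f r) a]
      simp
    have hm := measurable_exponentialPDF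
    have hm1 : Measurable fun z : ℝ × ℝ => exponentialPDF 1 (z.2 - z.1) * f z.2 :=
      ((hm 1).comp (measurable_snd.sub measurable_fst)).mul (hf.comp measurable_snd)
    have hm2 : Measurable fun z : ℝ × ℝ => exponentialPDF 2 z.1 *
        (exponentialPDF 1 (z.2 - z.1) * f z.2) := ((hm 2).comp measurable_fst).mul hm1
    simp_rw [e1]
    rw [lintegral_expMeasure _ hm1.lintegral_prod_right']
    calc _ = ∫⁻ a, ∫⁻ r, exponentialPDF 2 a * (exponentialPDF 1 (r - a) * f r) :=
          lintegral_congr fun a => (lintegral_const_mul _ (by fun_prop)).symm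
      _ = ∫⁻ r, ∫⁻ a, exponentialPDF 2 a * (exponentialPDF 1 (r - a) * f r) :=
          lintegral_lintegral_swap hm2.aemeasurable
      _ = _ := by
          refine lintegral_congr fun r => ?_
          simp_rw [← mul_assoc]
          exact lintegral_mul_const _
            ((hm 2).mul ((hm 1).comp (measurable_const.sub measurable_id)))
  have hms : Measurable fun r => ∫⁻ a, exponentialPDF 2 a * exponentialPDF 1 (r - a) := by
    have hm := measurable_exponentialPDF
    exact Measurable.lintegral_prod_right' (f := fun z : ℝ × ℝ =>
      exponentialPDF 2 z.2 * exponentialPDF 1 (z.1 - z.2))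
      (((hm 2).comp measurable_snd).mul ((hm 1).comp (measurable_fst.sub measurable_snd)))
  have hmg : Measurable fun r =>
      2⁻¹ * ((∫⁻ a, exponentialPDF 2 a * exponentialPDF 1 (r - a)) * f r) :=
    (hms.mul hf).const_mul _
  rw [hconv, lintegral_expMeasure _ hf, lintegral_expMeasure _ hf,
    ← lintegral_const_mul' _ _ (by simp), ← lintegral_const_mul' _ _ (by simp),
    ← lintegral_add_right _ hmg]
  refine lintegral_congr fun r => ?_
  conv_lhs => rw [hsum r]
  ring

/-! ### Clocks -/

/-- The time of the last of the first `k` rings. -/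
noncomputable def elapsed {M : Type} (c : Clock M) (k : ℕ) : ℝ :=
  ∑ i ∈ Finset.range k, (c i).1

section Clock

variable {M : Type} {c c' : Clock M} {k : ℕ}

@[simp] theorem elapsed_zero (c : Clock M) : elapsed c 0 = 0 := by simp [elapsed]

theorem elapsed_succ (c : Clock M) (k : ℕ) : elapsed c (k + 1) = elapsed c k + (c k).1 :=
  Finset.sum_range_succ _ _

theorem ringTime_eq (c : Clock M) (k : ℕ) : ringTime c k = elapsed c (k + 1) := rfl

theorem elapsed_congr (h : ∀ i < k, c i = c' i) : elapsed c k = elapsed c' k :=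
  Finset.sum_congr rfl fun i hi => by rw [h i (Finset.mem_range.1 hi)]

theorem elapsed_update_of_le {j : ℕ} (hjk : j ≤ k) (c : Clock M) (z : ℝ × M) :
    elapsed (Function.update c k z) j = elapsed c j :=
  elapsed_congr fun i hi => Function.update_of_ne (by omega) _ _

theorem elapsed_update_succ (c : Clock M) (k : ℕ) (z : ℝ × M) :
    elapsed (Function.update c k z) (k + 1) = elapsed c k + z.1 := by
  rw [elapsed_succ, elapsed_update_of_le le_rfl, Function.update_self]

theorem elapsed_strictMono (h : ∀ i, 0 < (c i).1) : StrictMono (elapsed c) :=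
  strictMono_nat_of_lt_succ fun k => by rw [elapsed_succ]; linarith [h k]

theorem elapsed_nonneg (h : ∀ i, 0 < (c i).1) (k : ℕ) : 0 ≤ elapsed c k :=
  Finset.sum_nonneg fun i _ => (h i).le

theorem update_pos (h : ∀ i, 0 < (c i).1) {z : ℝ × M} (hz : 0 < z.1) (k : ℕ) (i : ℕ) :
    0 < (Function.update c k z i).1 := by
  by_cases hi : i = k
  · subst hi; simpa
  · rw [Function.update_of_ne hi]; exact h i

theorem ringCount_eq (hc : ∀ i, 0 < (c i).1) {t : ℝ≥0} (h1 : elapsed c k ≤ t)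
    (h2 : t < elapsed c (k + 1)) : ringCount c t = k := by
  have : {j : ℕ | ringTime c j ≤ t} = Set.Iio k := by
    ext j
    simp only [Set.mem_ofPred_eq, ringTime_eq, Set.mem_Iio]
    refine ⟨fun h => ?_, fun h => ((elapsed_strictMono hc).monotone (by omega)).trans h1⟩
    have := (elapsed_strictMono hc).lt_iff_lt.1 (h.trans_lt h2)
    omega
  rw [ringCount, this, Set.ncard_eq_toFinset_card']
  simp

theorem exists_elapsed_bracket (c : Clock M) {t : ℝ} (h0 : 0 ≤ t) {k : ℕ}
    (h : t < elapsed c (k + 1)) : ∃ j ≤ k, elapsed c j ≤ t ∧ t < elapsed c (j + 1) := by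
  induction k with
  | zero => exact ⟨0, le_rfl, by simpa using h0, h⟩
  | succ k ih =>
    by_cases hk : t < elapsed c (k + 1)
    · obtain ⟨j, hj, h⟩ := ih hk
      exact ⟨j, by omega, h⟩
    · exact ⟨k + 1, le_rfl, not_lt.1 hk, h⟩

theorem stateAfter_congr (b : Bool) {c c' : Clock Bool} {k : ℕ} (h : ∀ i < k, c i = c' i) :
    stateAfter b c k = stateAfter b c' k := by
  cases k with
  | zero => rfl
  | succ k => simp [stateAfter, h k (Nat.lt_succ_self k)]

/-- Two clocks agreeing on their first `k` rings, and both having at most `k` rings until time `s`,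
produce the same signals until time `s`. -/
theorem stateAfter_ringCount_congr (b : Bool) {c c' : Clock Bool} {k : ℕ}
    (hc : ∀ i, 0 < (c i).1) (hc' : ∀ i, 0 < (c' i).1) (h : ∀ i < k, c i = c' i) {s r : ℝ≥0}
    (hs : s < elapsed c (k + 1)) (hs' : s < elapsed c' (k + 1)) (hr : r ≤ s) :
    stateAfter b c (ringCount c r) = stateAfter b c' (ringCount c' r) := by
  have hr' : (r : ℝ) ≤ s := by exact_mod_cast hr
  obtain ⟨j, hj, h1, h2⟩ := exists_elapsed_bracket c r.2 (hr'.trans_lt hs)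
  have h1' : elapsed c' j ≤ r := by
    rwa [← elapsed_congr (c := c) fun i hi => h i (by omega)]
  have h2' : r < elapsed c' (j + 1) := by
    rcases hj.lt_or_eq with hj | rfl
    · rwa [← elapsed_congr (c := c) fun i hi => h i (by omega)]
    · exact hr'.trans_lt hs'
  rw [ringCount_eq hc h1 h2, ringCount_eq hc' h1' h2']
  exact stateAfter_congr b fun i hi => h i (by omega)

end Clock

/-! ### Measurability and non-explosion of clocks -/

section ClockMeasurability

variable {M : Type} [MeasurableSpace M]

@[fun_prop]
theorem measurable_elapsed (k : ℕ) : Measurable fun c : Clock M => elapsed c k := by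
  unfold elapsed; fun_prop

@[fun_prop]
theorem measurable_ringTime (k : ℕ) : Measurable fun c : Clock M => ringTime c k :=
  measurable_elapsed (k + 1)

theorem measurable_ringCount : Measurable fun z : Clock M × ℝ≥0 => ringCount z.1 z.2 := by
  have hk (k : ℕ) : MeasurableSet {z : Clock M × ℝ≥0 | ringTime z.1 k ≤ z.2} :=
    measurableSet_le (by fun_prop) (by fun_prop)
  have hF (F : Finset ℕ) :
      MeasurableSet {z : Clock M × ℝ≥0 | {k : ℕ | ringTime z.1 k ≤ z.2} = (F : Set ℕ)} := by
    have : {z : Clock M × ℝ≥0 | {k : ℕ | ringTime z.1 k ≤ z.2} = (F : Set ℕ)} =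
        ⋂ k : ℕ, {z | ringTime z.1 k ≤ z.2 ↔ k ∈ F} := by
      ext z; simp [Set.ext_iff]
    rw [this]
    refine MeasurableSet.iInter fun k => ?_
    by_cases h : k ∈ F
    · simpa [h] using hk k
    · simpa only [h, iff_false] using! (hk k).compl
  have hm (m : ℕ) : MeasurableSet {z : Clock M × ℝ≥0 | ringCount z.1 z.2 = m + 1} := by
    have : {z : Clock M × ℝ≥0 | ringCount z.1 z.2 = m + 1} =
        ⋃ F : Finset ℕ, {z | F.card = m + 1 ∧ {k : ℕ | ringTime z.1 k ≤ z.2} = (F : Set ℕ)} := by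
      ext z
      simp only [Set.mem_ofPred_eq, Set.mem_iUnion, ringCount]
      constructor
      · intro h
        have hfin := Set.finite_of_ncard_ne_zero (h.trans_ne m.succ_ne_zero)
        exact ⟨hfin.toFinset, by rw [← h, Set.ncard_eq_toFinset_card _ hfin], by simp⟩
      · rintro ⟨F, h1, h2⟩
        rw [h2, Set.ncard_coe_finset, h1]
    rw [this]
    refine MeasurableSet.iUnion fun F => ?_
    by_cases h : F.card = m + 1
    · simpa [h] using hF F
    · simp [h]
  -- The value $0$ is obtained as the complement of the positive values: it also collects the clocks
  -- with infinitely many rings, whose `Set.ncard` is $0$ by convention.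
  refine measurable_to_countable' fun m => ?_
  cases m with
  | succ m => exact hm m
  | zero =>
    have : (fun z : Clock M × ℝ≥0 => ringCount z.1 z.2) ⁻¹' {0} =
        (⋃ m : ℕ, {z | ringCount z.1 z.2 = m + 1})ᶜ := by
      ext z
      simp only [Set.mem_preimage, Set.mem_singleton_iff, Set.mem_compl_iff, Set.mem_iUnion,
        Set.mem_ofPred_eq, not_exists]
      exact ⟨fun h m => by omega, fun h => by
        by_contra h0; exact h (ringCount z.1 z.2 - 1) (by omega)⟩
    rw [this]
    exact (MeasurableSet.iUnion hm).compl

theorem measurable_stateAfter (b : Bool) (k : ℕ) :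
    Measurable fun c : Clock Bool => stateAfter b c k := by
  cases k with
  | zero => exact measurable_const
  | succ k => simp only [stateAfter]; fun_prop

theorem measurable_environment {n d : ℕ} (η₀ : Config n d) :
    Measurable fun z : (Edge n d → Clock Bool) × ℝ≥0 => environment η₀ z.1 z.2 := by
  refine measurable_pi_iff.2 fun e => ?_
  have h1 : Measurable fun z : Clock Bool × ℕ => stateAfter (η₀ e) z.1 z.2 :=
    measurable_from_prod_countable_left fun k => measurable_stateAfter _ k
  exact h1.comp (Measurable.prodMk (by fun_prop)
    (measurable_ringCount.comp (Measurable.prodMk (by fun_prop) (by fun_prop))))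

variable {r : ℝ} {ν : Measure M} [IsProbabilityMeasure ν]

theorem lintegral_clockLaw_update (hr : 0 < r) (k : ℕ) {f : Clock M → ℝ≥0∞} (hf : Measurable f) :
    ∫⁻ c, f c ∂clockLaw r ν =
      ∫⁻ c, ∫⁻ z, f (Function.update c k z) ∂(expMeasure r).prod ν ∂clockLaw r ν := by
  have := isProbabilityMeasure_expMeasure hr
  exact lintegral_infinitePi_update (fun _ : ℕ => (expMeasure r).prod ν) k hf

theorem ae_clockLaw_pos (hr : 0 < r) : ∀ᵐ c ∂clockLaw r ν, ∀ i, 0 < (c i).1 := by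
  have := isProbabilityMeasure_expMeasure hr
  refine ae_all_iff.2 fun i => ?_
  have h1 : ∀ᵐ z ∂(expMeasure r).prod ν, 0 < z.1 :=
    Measure.quasiMeasurePreserving_fst.ae (ae_expMeasure_pos r)
  exact (measurePreserving_eval_infinitePi
    (fun _ : ℕ => (expMeasure r).prod ν) i).quasiMeasurePreserving.ae h1

theorem lintegral_exp_neg_elapsed (hr : 0 < r) (k : ℕ) :
    ∫⁻ c, ENNReal.ofReal (Real.exp (-elapsed c k)) ∂clockLaw r ν =
      ENNReal.ofReal (r / (r + 1)) ^ k := by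
  have := isProbabilityMeasure_clockLaw hr ν
  have := isProbabilityMeasure_expMeasure hr
  induction k with
  | zero => simp
  | succ k ih =>
    rw [lintegral_clockLaw_update hr k (by fun_prop), pow_succ, ← ih, ← lintegral_mul_const _
      (by fun_prop)]
    refine lintegral_congr fun c => ?_
    simp only [elapsed_update_succ, neg_add, Real.exp_add]
    have h := lintegral_exp_neg_expMeasure hr zero_le_one
    rw [← h, ← lintegral_const_mul' _ _ ENNReal.ofReal_ne_top]
    rw [lintegral_prod _ (by fun_prop)]
    refine lintegral_congr fun x => ?_
    simp [ENNReal.ofReal_mul (Real.exp_pos _).le]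

/-- Non-explosion by the exponential Markov inequality: the Laplace transform of the $k$-th ring
time is $(r/(r+1))^k$, which tends to $0$. -/
theorem ae_exists_lt_elapsed (hr : 0 < r) (s : ℝ) :
    ∀ᵐ c ∂clockLaw r ν, ∃ k, s < elapsed c (k + 1) := by
  have := isProbabilityMeasure_clockLaw hr ν
  rw [ae_iff]
  have hbound (k : ℕ) : clockLaw r ν {c | ¬∃ k, s < elapsed c (k + 1)} ≤
      ENNReal.ofReal (Real.exp s) * ENNReal.ofReal (r / (r + 1)) ^ (k + 1) := by
    rw [← lintegral_exp_neg_elapsed (ν := ν) hr, ← lintegral_const_mul' _ _ ENNReal.ofReal_ne_top]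
    have hms : MeasurableSet {c : Clock M | ¬∃ k, s < elapsed c (k + 1)} := by
      have h : {c : Clock M | ¬∃ k, s < elapsed c (k + 1)} =
          (⋃ k, {c | s < elapsed c (k + 1)})ᶜ := by
        ext; simp
      rw [h]
      exact (MeasurableSet.iUnion fun k => measurableSet_lt measurable_const (by fun_prop)).compl
    rw [← lintegral_indicator_one hms]
    refine lintegral_mono (Set.indicator_le fun c hc => ?_)
    simp only [Set.mem_ofPred_eq, not_exists, not_lt] at hc
    rw [← ENNReal.ofReal_mul (Real.exp_pos _).le, ← Real.exp_add]
    simpa using hc k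
  have hlt : ENNReal.ofReal (r / (r + 1)) < 1 := by
    rw [ENNReal.ofReal_lt_one, div_lt_one (by positivity)]; linarith
  have hlim := ((ENNReal.tendsto_pow_atTop_nhds_zero_of_lt_one hlt).comp
    (Filter.tendsto_add_atTop_nat 1))
  have hlim2 := ENNReal.Tendsto.const_mul (a := ENNReal.ofReal (Real.exp s)) hlim
    (Or.inr ENNReal.ofReal_ne_top)
  rw [mul_zero] at hlim2
  exact le_antisymm (ge_of_tendsto' hlim2 hbound) bot_le

end ClockMeasurability

/-! ### Opening probabilities given the past -/

section Opening

variable {p : unitInterval} {μ : ℝ} {s t : ℝ≥0}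

theorem expMeasure_Ioc {r : ℝ} (hr : 0 < r) {x y : ℝ} (hx : 0 ≤ x) (hxy : x ≤ y) :
    expMeasure r (Set.Ioc x y) =
      ENNReal.ofReal (1 - Real.exp (-(r * (y - x)))) * expMeasure r (Set.Ioi x) := by
  have := isProbabilityMeasure_expMeasure hr
  rw [← Set.Ioi_sdiff_Ioi, measure_sdiff (Set.Ioi_subset_Ioi hxy)
    measurableSet_Ioi.nullMeasurableSet
    (measure_ne_top _ _), expMeasure_Ioi hr hx, expMeasure_Ioi hr (hx.trans hxy),
    ← ENNReal.ofReal_sub _ (Real.exp_pos _).le, ← ENNReal.ofReal_mul]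
  · congr 1
    rw [sub_mul, ← Real.exp_add]
    ring_nf
  · rw [sub_nonneg, Real.exp_le_one_iff]
    nlinarith

/-- It suffices that the first signal after $s$ arrives by $t$, is an opening one, and is followed
by a pause longer than $t-s$. By memorylessness these events contribute the factors
$1-e^{-\mu(t-s)}$, $p$ and $e^{-\mu(t-s)}$, independently of the past. The hypothesis `hadapt` makes
$g$ a function of the past of the edge up to $s$. -/
theorem lintegral_open_clock (hμ : 0 < μ) (hst : s ≤ t) (b : Bool) {g : Clock Bool → ℝ≥0∞}
    (hg : Measurable g)
    (hadapt : ∀ c c', (∀ r ≤ s, stateAfter b c (ringCount c r) = stateAfter b c' (ringCount c' r)) →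
      g c = g c') :
    ENNReal.ofReal (p * (1 - Real.exp (-(μ * (t - s)))) * Real.exp (-(μ * (t - s)))) *
        ∫⁻ c, g c ∂clockLaw μ (bernoulliMeasure true false p) ≤
      ∫⁻ c, (if stateAfter b c (ringCount c t) = true then g c else 0)
        ∂clockLaw μ (bernoulliMeasure true false p) := by
  set ν := bernoulliMeasure true false p with hν
  have hprob := isProbabilityMeasure_clockLaw hμ ν
  have hexp := isProbabilityMeasure_expMeasure hμ
  have hst' : (s : ℝ) ≤ t := by exact_mod_cast hst
  have hp0 : 0 ≤ (p : ℝ) := p.2.1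
  have he0 : 0 ≤ 1 - Real.exp (-(μ * (t - s))) := by
    rw [sub_nonneg, Real.exp_le_one_iff]; nlinarith
  have hνtrue : ν {true} = ENNReal.ofReal p := by
    rw [hν, bernoulliMeasure_apply_of_mem_of_notMem _ (by measurability) (by simp) (by simp)]
    exact (ENNReal.ofReal_eq_coe_nnreal hp0).symm
  have hpos := ae_clockLaw_pos (ν := ν) hμ
  have hposz : ∀ᵐ z ∂(expMeasure μ).prod ν, 0 < z.1 :=
    Measure.quasiMeasurePreserving_fst.ae (ae_expMeasure_pos μ)
  -- `D k` says that the clock rings exactly `k` times until time `s`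
  let D (k : ℕ) : Set (Clock Bool) := {c | elapsed c k ≤ s} ∩ {c | s < elapsed c (k + 1)}
  have hD (k : ℕ) : MeasurableSet (D k) :=
    (measurableSet_le (by fun_prop) measurable_const).inter
      (measurableSet_lt measurable_const (by fun_prop))
  have hDdisj (c : Clock Bool) (hc : ∀ i, 0 < (c i).1) (k j : ℕ) (hk : c ∈ D k) (hj : c ∈ D j) :
      k = j := by rw [← ringCount_eq hc hk.1 hk.2, ringCount_eq hc hj.1 hj.2]
  have hsplit {f : Clock Bool → ℝ≥0∞} (hf : Measurable f) :
      ∫⁻ c, f c ∂clockLaw μ ν = ∑' k, ∫⁻ c, (D k).indicator f c ∂clockLaw μ ν := by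
    rw [← lintegral_tsum fun k => (hf.indicator (hD k)).aemeasurable]
    refine lintegral_congr_ae ?_
    filter_upwards [hpos, ae_exists_lt_elapsed (ν := ν) hμ s] with c hc ⟨K, hK⟩
    obtain ⟨k, -, h1, h2⟩ := exists_elapsed_bracket c s.2 hK
    rw [tsum_eq_single k, Set.indicator_of_mem (show c ∈ D k from ⟨h1, h2⟩)]
    intro j hj
    exact Set.indicator_of_notMem (fun h => hj (hDdisj c hc _ _ h ⟨h1, h2⟩)) _
  have hstate : Measurable fun c : Clock Bool => stateAfter b c (ringCount c t) := by
    have h1 : Measurable fun z : Clock Bool × ℕ => stateAfter b z.1 z.2 :=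
      measurable_from_prod_countable_left fun k => measurable_stateAfter _ k
    exact h1.comp (measurable_id.prodMk (measurable_ringCount.comp
      (measurable_id.prodMk measurable_const)))
  have hms : MeasurableSet {c : Clock Bool | stateAfter b c (ringCount c t) = true} :=
    hstate (measurableSet_singleton true)
  rw [hsplit hg, hsplit (hg.ite hms measurable_const), ← ENNReal.tsum_mul_left]
  refine ENNReal.tsum_le_tsum fun k => ?_
  -- ring number `k` is an opening signal in `(s, t]`, and the next one comes after time `t`
  let B : Set (Clock Bool) := {c | elapsed c (k + 1) ≤ t} ∩ {c | (c k).2 = true}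
  have hB : MeasurableSet B :=
    (measurableSet_le (by fun_prop) measurable_const).inter
      (measurableSet_eq_fun (by fun_prop) measurable_const)
  let L : Set (Clock Bool) := {c | (t : ℝ) - s < (c (k + 1)).1}
  have hL : MeasurableSet L := measurableSet_lt measurable_const (by fun_prop)
  have hlower : ∫⁻ c, (D k ∩ B ∩ L).indicator g c ∂clockLaw μ ν ≤
      ∫⁻ c, (D k).indicator
        (fun c => if stateAfter b c (ringCount c t) = true then g c else 0) c ∂clockLaw μ ν := by
    refine lintegral_mono_ae ?_
    filter_upwards [hpos] with c hc
    by_cases h : c ∈ D k ∩ B ∩ L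
    · have h1 : elapsed c (k + 1) ≤ t := h.1.2.1
      have h2 : (c k).2 = true := h.1.2.2
      have h3 : (t : ℝ) - s < (c (k + 1)).1 := h.2
      have h4 : s < elapsed c (k + 1) := h.1.1.2
      have hcount : ringCount c t = k + 1 :=
        ringCount_eq hc h1 (by rw [elapsed_succ c (k + 1)]; linarith)
      rw [Set.indicator_of_mem h, Set.indicator_of_mem h.1.1, if_pos]
      rw [hcount]
      exact h2
    · rw [Set.indicator_of_notMem h]
      exact bot_le
  refine le_trans ?_ hlower
  -- Redraw coordinate $k+1$: neither `D k`, nor `B`, nor $g$ on `D k` depends on it, so the pause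
  -- factors out.
  have hstep1 : ∫⁻ c, (D k ∩ B ∩ L).indicator g c ∂clockLaw μ ν =
      ENNReal.ofReal (Real.exp (-(μ * (t - s)))) *
        ∫⁻ c, (D k ∩ B).indicator g c ∂clockLaw μ ν := by
    rw [lintegral_clockLaw_update hμ (k + 1) (hg.indicator (((hD k).inter hB).inter hL)),
      ← lintegral_const_mul' _ _ ENNReal.ofReal_ne_top]
    refine lintegral_congr_ae ?_
    filter_upwards [hpos] with c hc
    have : ∀ᵐ z ∂(expMeasure μ).prod ν,
        (D k ∩ B ∩ L).indicator g (Function.update c (k + 1) z) =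
          (D k ∩ B).indicator g c * (Set.Ioi ((t : ℝ) - s) ×ˢ Set.univ).indicator 1 z := by
      filter_upwards [hposz] with z hz
      have hE : elapsed (Function.update c (k + 1) z) (k + 1) = elapsed c (k + 1) :=
        elapsed_update_of_le le_rfl _ _
      have hDB : Function.update c (k + 1) z ∈ D k ∩ B ↔ c ∈ D k ∩ B := by
        change (_ ∧ _) ∧ _ ∧ _ ↔ (_ ∧ _) ∧ _ ∧ _
        simp only [Set.mem_ofPred_eq, hE, elapsed_update_of_le (Nat.le_succ k),
          Function.update_of_ne (Nat.succ_ne_self k).symm]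
      have hLz : Function.update c (k + 1) z ∈ L ↔ z ∈ Set.Ioi ((t : ℝ) - s) ×ˢ Set.univ := by
        simp [L]
      by_cases h1 : c ∈ D k ∩ B
      · by_cases h2 : z ∈ Set.Ioi ((t : ℝ) - s) ×ˢ (Set.univ : Set Bool)
        · rw [Set.indicator_of_mem
              (show Function.update c (k + 1) z ∈ D k ∩ B ∩ L from ⟨hDB.2 h1, hLz.2 h2⟩),
            Set.indicator_of_mem h1,
            Set.indicator_of_mem h2, Pi.one_apply, mul_one]
          refine hadapt _ _ fun r hr => stateAfter_ringCount_congr b (update_pos hc hz _) hc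
            (k := k) (fun i hi => Function.update_of_ne (by omega) _ _) ?_ h1.1.2 hr
          rw [hE]
          exact h1.1.2
        · rw [Set.indicator_of_notMem h2, mul_zero,
            Set.indicator_of_notMem fun h => h2 (hLz.1 h.2)]
      · rw [Set.indicator_of_notMem h1, zero_mul,
          Set.indicator_of_notMem fun h => h1 (hDB.1 h.1)]
    rw [lintegral_congr_ae this, lintegral_const_mul _
      (measurable_one.indicator (measurableSet_Ioi.prod MeasurableSet.univ)),
      lintegral_indicator_one (measurableSet_Ioi.prod MeasurableSet.univ), Measure.prod_prod,
      measure_univ, mul_one, expMeasure_Ioi hμ (sub_nonneg.2 hst'), mul_comm]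
  have hstep2 : ∫⁻ c, (D k ∩ B).indicator g c ∂clockLaw μ ν =
      ENNReal.ofReal (p * (1 - Real.exp (-(μ * (t - s))))) *
        ∫⁻ c, (D k).indicator g c ∂clockLaw μ ν := by
    rw [lintegral_clockLaw_update hμ k (hg.indicator ((hD k).inter hB)),
      lintegral_clockLaw_update hμ k (hg.indicator (hD k)),
      ← lintegral_const_mul' _ _ ENNReal.ofReal_ne_top]
    refine lintegral_congr_ae ?_
    filter_upwards [hpos] with c hc
    by_cases hcs : elapsed c k ≤ s
    -- Once ring $k$ falls after $s$, its time and mark are invisible to $g$; the waiting time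
    -- $s+1-$`elapsed c k` with mark `true` is an arbitrary representative. What is left is the
    -- memoryless law of one waiting time and its mark.
    · set G := g (Function.update c k (s + 1 - elapsed c k, true)) with hG
      have hmem (z : ℝ × Bool) : Function.update c k z ∈ D k ↔
          z ∈ Set.Ioi (s - elapsed c k) ×ˢ (Set.univ : Set Bool) := by
        change _ ∧ _ ↔ _
        simp [elapsed_update_of_le le_rfl, elapsed_update_succ, hcs, sub_lt_iff_lt_add']
      have hmemB (z : ℝ × Bool) : Function.update c k z ∈ B ↔
          z.1 ≤ t - elapsed c k ∧ z.2 = true := by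
        change _ ∧ _ ↔ _
        simp [elapsed_update_succ, le_sub_iff_add_le']
      have hgG (z : ℝ × Bool) (hz : (s : ℝ) - elapsed c k < z.1) :
          g (Function.update c k z) = G := by
        refine hadapt _ _ fun r hr => stateAfter_ringCount_congr b
          (update_pos hc (by linarith) _) (update_pos hc (by simp; linarith) _)
          (k := k) (fun i hi => ?_) ?_ ?_ hr
        · rw [Function.update_of_ne (by omega), Function.update_of_ne (by omega)]
        · rw [elapsed_update_succ]; linarith
        · rw [elapsed_update_succ]; simp
      have e1 (z : ℝ × Bool) : (D k).indicator g (Function.update c k z) =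
          G * (Set.Ioi (s - elapsed c k) ×ˢ (Set.univ : Set Bool)).indicator 1 z := by
        by_cases h : z ∈ Set.Ioi (s - elapsed c k) ×ˢ (Set.univ : Set Bool)
        · rw [Set.indicator_of_mem h, Set.indicator_of_mem ((hmem z).2 h), hgG z h.1]
          simp
        · rw [Set.indicator_of_notMem h, Set.indicator_of_notMem (mt (hmem z).1 h), mul_zero]
      have e2 (z : ℝ × Bool) : (D k ∩ B).indicator g (Function.update c k z) =
          G * (Set.Ioc (s - elapsed c k) (t - elapsed c k) ×ˢ {true}).indicator 1 z := by
        by_cases h : z ∈ Set.Ioc (s - elapsed c k) (t - elapsed c k) ×ˢ {true}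
        · rw [Set.indicator_of_mem h, Set.indicator_of_mem
            (show Function.update c k z ∈ D k ∩ B from
              ⟨(hmem z).2 ⟨h.1.1, trivial⟩, (hmemB z).2 ⟨h.1.2, h.2⟩⟩), hgG z h.1.1]
          simp
        · rw [Set.indicator_of_notMem h, mul_zero, Set.indicator_of_notMem]
          rintro ⟨h1, h2⟩
          exact h ⟨⟨((hmem z).1 h1).1, ((hmemB z).1 h2).1⟩, ((hmemB z).1 h2).2⟩
      have m1 : MeasurableSet (Set.Ioi (s - elapsed c k) ×ˢ (Set.univ : Set Bool)) :=
        measurableSet_Ioi.prod MeasurableSet.univ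
      have m2 : MeasurableSet (Set.Ioc (s - elapsed c k) (t - elapsed c k) ×ˢ {true}) :=
        measurableSet_Ioc.prod (measurableSet_singleton _)
      simp_rw [e1, e2]
      rw [lintegral_const_mul _ (measurable_one.indicator m1), lintegral_indicator_one m1,
        lintegral_const_mul _ (measurable_one.indicator m2), lintegral_indicator_one m2,
        Measure.prod_prod, Measure.prod_prod, measure_univ, hνtrue,
        expMeasure_Ioc hμ (by linarith) (by linarith), ENNReal.ofReal_mul hp0]
      rw [show (t : ℝ) - elapsed c k - (s - elapsed c k) = t - s by ring]
      ring
    · have h1 (z : ℝ × Bool) : Function.update c k z ∉ D k := fun h =>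
        hcs (by simpa [elapsed_update_of_le le_rfl] using h.1)
      simp [Set.indicator_of_notMem (h1 _),
        Set.indicator_of_notMem fun h : _ ∈ D k ∩ B => h1 _ h.1]
  rw [hstep1, hstep2, ← mul_assoc, ← ENNReal.ofReal_mul (Real.exp_pos _).le]
  refine le_of_eq ?_
  congr 2
  ring

/-- Given the past up to time `s`, an edge is open at a later time `t` with a probability bounded
below. -/
theorem lintegral_open_environment {n d : ℕ} (η₀ : Config n d) (hμ : 0 < μ) (hst : s ≤ t)
    (e : Edge n d) {g : (Edge n d → Clock Bool) → ℝ≥0∞} (hg : Measurable g)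
    (hadapt : ∀ ω ω', (∀ r ≤ s, environment η₀ ω r = environment η₀ ω' r) → g ω = g ω') :
    ENNReal.ofReal (p * (1 - Real.exp (-(μ * (t - s)))) * Real.exp (-(μ * (t - s)))) *
        ∫⁻ ω, g ω ∂envNoise n d p μ ≤
      ∫⁻ ω, (if environment η₀ ω t e = true then g ω else 0) ∂envNoise n d p μ := by
  classical
  have := isProbabilityMeasure_clockLaw hμ (bernoulliMeasure true false p)
  have hms : MeasurableSet {ω | environment η₀ ω t e = true} := by
    have h1 := (measurable_environment η₀).comp (measurable_id.prodMk (measurable_const (a := t)))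
    exact ((measurable_pi_apply e).comp h1) (measurableSet_singleton true)
  rw [envNoise, lintegral_infinitePi_update _ e hg, lintegral_infinitePi_update _ e
    (hg.ite hms measurable_const), ← lintegral_const_mul' _ _ ENNReal.ofReal_ne_top]
  -- With the clocks of the other edges frozen, $g$ is adapted to the single edge `e`, and the
  -- one-clock bound applies.
  refine lintegral_mono fun ω => ?_
  have hupd : Measurable fun c : Clock Bool => Function.update ω e c :=
    measurable_update ω
  refine (lintegral_open_clock hμ hst (η₀ e) (hg.comp hupd) fun c c' h => ?_).trans_eq ?_
  · refine hadapt _ _ fun r hr => funext fun e' => ?_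
    by_cases he : e' = e
    · subst he; simpa [environment] using h r hr
    · simp [environment, Function.update_of_ne he]
  · simp [environment]

end Opening

/-! ### Chains driven by a clock -/

/-- The kernel that, with probability `1 / 2`, does nothing. -/
noncomputable def lazyKernel {V : Type} [DecidableEq V] (K : ℝ → V → V → ℝ≥0) : ℝ → V → V → ℝ≥0 :=
  fun t x y => 2⁻¹ * ((if x = y then 1 else 0) + K t x y)

theorem measurable_lazyKernel {V : Type} [DecidableEq V] {K : ℝ → V → V → ℝ≥0}
    (hK : ∀ x y, Measurable fun t => K t x y)
    (x y : V) :
    Measurable fun t => lazyKernel K t x y := by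
  unfold lazyKernel
  exact ((hK x y).const_add _).const_mul _

section Chain

variable {V : Type} [Fintype V]

/-- Wait for an exponential time of rate `r`, then apply the kernel in force at that time. -/
noncomputable def jump (r : ℝ) (K : ℝ → V → V → ℝ≥0) (φ : ℝ → V → ℝ≥0∞) : ℝ → V → ℝ≥0∞ :=
  fun t x => ∫⁻ s, ∑ y, K (t + s) x y * φ (t + s) y ∂expMeasure r

variable {r : ℝ} {K : ℝ → V → V → ℝ≥0} {φ ψ : ℝ → V → ℝ≥0∞}

theorem measurable_jump_integrand (hK : ∀ x y, Measurable fun t => K t x y)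
    (hφ : ∀ x, Measurable fun t => φ t x) (x : V) :
    Measurable fun t : ℝ => ∑ y, K t x y * φ t y :=
  Finset.measurable_fun_sum _ fun y _ => ((hK x y).coe_nnreal_ennreal).mul (hφ y)

theorem measurable_jump (hr : 0 < r) (hK : ∀ x y, Measurable fun t => K t x y)
    (hφ : ∀ x, Measurable fun t => φ t x) (x : V) : Measurable fun t => jump r K φ t x := by
  have := isProbabilityMeasure_expMeasure hr
  exact Measurable.lintegral_prod_right' (f := fun z : ℝ × ℝ =>
    ∑ y, K (z.1 + z.2) x y * φ (z.1 + z.2) y)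
    ((measurable_jump_integrand hK hφ x).comp (measurable_fst.add measurable_snd))

theorem measurable_iterate_jump (hr : 0 < r) (hK : ∀ x y, Measurable fun t => K t x y)
    (hφ : ∀ x, Measurable fun t => φ t x) (k : ℕ) (x : V) :
    Measurable fun t => (jump r K)^[k] φ t x := by
  induction k generalizing x with
  | zero => exact hφ x
  | succ k ih =>
    simp only [Function.iterate_succ_apply']
    exact measurable_jump hr hK ih x

theorem jump_add (hK : ∀ x y, Measurable fun t => K t x y) (hφ : ∀ x, Measurable fun t => φ t x) :
    jump r K (φ + ψ) = jump r K φ + jump r K ψ := by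
  ext t x
  simp only [jump, Pi.add_apply, mul_add, Finset.sum_add_distrib]
  exact lintegral_add_left ((measurable_jump_integrand hK hφ x).comp (measurable_const_add t)) _

theorem jump_const_mul {c : ℝ≥0∞} (hc : c ≠ ∞) :
    jump r K (fun t x => c * φ t x) = fun t x => c * jump r K φ t x := by
  ext t x
  simp only [jump]
  rw [← lintegral_const_mul' _ _ hc]
  refine lintegral_congr fun s => ?_
  rw [Finset.mul_sum]
  exact Finset.sum_congr rfl fun y _ => by ring

theorem jump_mono : Monotone (jump (V := V) r K) := fun _ _ h t _ =>
  lintegral_mono fun s => Finset.sum_le_sum fun y _ => mul_le_mul_right (h (t + s) y) _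

theorem jump_one_le (hr : 0 < r) (hK : ∀ t x, ∑ y, K t x y ≤ 1) : jump r K 1 ≤ 1 := fun t x => by
  have := isProbabilityMeasure_expMeasure hr
  calc jump r K 1 t x ≤ ∫⁻ _, 1 ∂expMeasure r := by
        refine lintegral_mono fun s => ?_
        simp only [Pi.one_apply, mul_one]
        exact_mod_cast hK (t + s) x
    _ = 1 := by simp

/-- The total of the iterated rate `1` jumps until a fixed number of jumps. -/
noncomputable def jumpSum (K : ℝ → V → V → ℝ≥0) : ℕ → ℝ → V → ℝ≥0∞
  | 0 => 0
  | N + 1 => 1 + jump 1 K (jumpSum K N)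

theorem measurable_jumpSum (hK : ∀ x y, Measurable fun t => K t x y) (N : ℕ) (x : V) :
    Measurable fun t => jumpSum K N t x := by
  induction N generalizing x with
  | zero => exact measurable_const
  | succ N ih => exact measurable_const.add (measurable_jump one_pos hK ih x)

theorem jumpSum_succ (hK : ∀ x y, Measurable fun t => K t x y) (N : ℕ) :
    jumpSum K (N + 1) = jumpSum K N + (jump 1 K)^[N] 1 := by
  induction N with
  | zero =>
    ext t x
    simp [jumpSum, jump]
  | succ N ih =>
    calc jumpSum K (N + 2) = 1 + jump 1 K (jumpSum K (N + 1)) := rfl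
      _ = 1 + jump 1 K (jumpSum K N + (jump 1 K)^[N] 1) := by rw [ih]
      _ = _ := by
        rw [jump_add hK (measurable_jumpSum hK N), ← add_assoc, Function.iterate_succ_apply']
        rfl

theorem jumpSum_eq_sum (hK : ∀ x y, Measurable fun t => K t x y) (N : ℕ) (t : ℝ) (x : V) :
    jumpSum K N t x = ∑ k ∈ Finset.range N, (jump 1 K)^[k] 1 t x := by
  induction N with
  | zero => rfl
  | succ N ih => rw [jumpSum_succ hK, Finset.sum_range_succ, ← ih]; rfl

theorem jumpSum_le (hK : ∀ t x, ∑ y, K t x y ≤ 1) (N : ℕ) (t : ℝ) (x : V) :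
    jumpSum K N t x ≤ N := by
  have h (N : ℕ) : jumpSum K N ≤ fun t x => (N : ℝ≥0∞) * (1 : ℝ → V → ℝ≥0∞) t x := by
    induction N with
    | zero => intro t x; simp [jumpSum]
    | succ N ih =>
      intro t x
      have h1 := jump_mono (r := 1) (K := K) ih t x
      rw [jump_const_mul (by simp)] at h1
      have h2 := jump_one_le one_pos hK t x
      calc jumpSum K (N + 1) t x = 1 + jump 1 K (jumpSum K N) t x := rfl
        _ ≤ 1 + N * 1 := by gcongr; exact h1.trans (mul_le_mul_right h2 _)
        _ = _ := by simp [add_comm]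
  simpa using h N t x

/-- Split the rate $1$ waiting time as in `lintegral_expMeasure_one`. After the rate $2$ piece, with
probability $1/2$ the jump occurs, and otherwise the chain waits afresh, which is one lazy rate $2$
step. The only loss is the replacement of `jumpSum K N` by `jumpSum K (N + 1)` after an actual jump.
-/
theorem jumpSum_le_lazy [DecidableEq V] (hK : ∀ x y, Measurable fun t => K t x y) (N : ℕ) :
    jumpSum K (N + 1) ≤
      (fun _ _ => 2⁻¹) + jump 2 (lazyKernel K) (jumpSum K (N + 1)) := by
  intro t x
  have hprob := isProbabilityMeasure_expMeasure (r := 2) two_pos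
  set H := jumpSum K (N + 1) with hH
  let ψ : ℝ → ℝ≥0∞ := fun t => ∑ y, K t x y * jumpSum K N t y
  have hψ : Measurable ψ := measurable_jump_integrand hK (measurable_jumpSum hK N) x
  have hHm : Measurable fun t => H t x := measurable_jumpSum hK (N + 1) x
  have hHψ (t : ℝ) : H t x = 1 + ∫⁻ s, ψ (t + s) ∂expMeasure 1 := rfl
  have hhalf : (2⁻¹ : ℝ≥0∞) + 2⁻¹ = 1 := ENNReal.inv_two_add_inv_two
  have h1 : ∫⁻ s, H (t + s) x ∂expMeasure 2 =
      1 + ∫⁻ a, ∫⁻ b, ψ (t + (a + b)) ∂expMeasure 1 ∂expMeasure 2 := by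
    simp_rw [hHψ, ← add_assoc]
    rw [lintegral_add_left measurable_const]
    simp
  have hmono : jumpSum K N ≤ H := by
    rw [hH, jumpSum_succ hK]; exact le_self_add
  calc H t x = 2⁻¹ + (2⁻¹ * ∫⁻ s, H (t + s) x ∂expMeasure 2 +
        2⁻¹ * ∫⁻ s, ψ (t + s) ∂expMeasure 2) := by
        rw [hHψ, h1, lintegral_expMeasure_one (f := fun s => ψ (t + s)) (by fun_prop)]
        conv_lhs => rw [← hhalf]
        ring
    _ = 2⁻¹ + ∫⁻ s, 2⁻¹ * (H (t + s) x + ψ (t + s)) ∂expMeasure 2 := by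
        rw [lintegral_const_mul' _ _ (by simp), lintegral_add_left (by fun_prop), mul_add]
    _ ≤ 2⁻¹ + jump 2 (lazyKernel K) H t x := by
        gcongr
        refine lintegral_mono fun s => ?_
        have e1 : ∑ y, (lazyKernel K (t + s) x y : ℝ≥0∞) * H (t + s) y =
            2⁻¹ * (H (t + s) x + ∑ y, K (t + s) x y * H (t + s) y) := by
          have e2 (y : V) : (lazyKernel K (t + s) x y : ℝ≥0∞) * H (t + s) y =
              2⁻¹ * ((if x = y then H (t + s) y else 0) + K (t + s) x y * H (t + s) y) := by
            unfold lazyKernel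
            push_cast [ENNReal.coe_inv]
            split_ifs <;> simp [add_mul, mul_assoc]
          simp_rw [e2]
          rw [← Finset.mul_sum, Finset.sum_add_distrib]
          simp
        rw [e1]
        gcongr
        exact Finset.sum_le_sum fun y _ => mul_le_mul_right (hmono (t + s) y) _

/-- Running the chain lazily at rate `2` does not decrease the expected number of jumps by more
than the factor `2`. -/
theorem tsum_iterate_jump_le [DecidableEq V] (hK : ∀ x y, Measurable fun t => K t x y)
    (hK1 : ∀ t x, ∑ y, K t x y ≤ 1) (t : ℝ) (x : V) :
    ∑' k, (jump 1 K)^[k] 1 t x ≤ 2⁻¹ * ∑' k, (jump 2 (lazyKernel K))^[k] 1 t x := by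
  have hQ := measurable_lazyKernel hK
  set L : (ℝ → V → ℝ≥0∞) → (ℝ → V → ℝ≥0∞) := jump 2 (lazyKernel K) with hL
  by_cases htop : ∑' k, L^[k] 1 t x = ∞
  · rw [htop, ENNReal.mul_top (by simp)]; exact le_top
  have hlim := ENNReal.tendsto_atTop_zero_of_tsum_ne_top htop
  rw [ENNReal.tsum_eq_iSup_nat]
  refine iSup_le fun N => ?_
  rw [← jumpSum_eq_sum hK]
  have hiter (c : ℝ≥0∞) (hc : c ≠ ∞) (j : ℕ) :
      L^[j] (fun _ _ => c) = fun t x => c * L^[j] 1 t x := by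
    induction j with
    | zero => ext; simp
    | succ j ih => rw [Function.iterate_succ_apply', ih, hL, jump_const_mul hc,
        Function.iterate_succ_apply']
  -- Iterating the lazy inequality leaves a remainder, the $J$-th lazy iterate of `jumpSum K (N +
  -- 1)`. Truncation at $N$ bounds this function by $N+1$, so the remainder vanishes as $J\to\infty$
  -- when the lazy series converges.
  have hunfold (J : ℕ) : jumpSum K (N + 1) ≤
      fun t x => ∑ j ∈ Finset.range J, L^[j] (fun _ _ => 2⁻¹) t x +
        L^[J] (jumpSum K (N + 1)) t x := by
    induction J with
    | zero => intro t x; simp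
    | succ J ih =>
      refine ih.trans fun t x => ?_
      have h1 : L^[J] (jumpSum K (N + 1)) ≤
          L^[J] ((fun _ _ => 2⁻¹) + L (jumpSum K (N + 1))) :=
        jump_mono.iterate J (jumpSum_le_lazy hK N)
      have h2 (j : ℕ) (φ ψ : ℝ → V → ℝ≥0∞) (hφ : ∀ x, Measurable fun t => φ t x) :
          L^[j] (φ + ψ) = L^[j] φ + L^[j] ψ := by
        induction j with
        | zero => rfl
        | succ j ih =>
          rw [Function.iterate_succ_apply', ih, hL,
            jump_add hQ (measurable_iterate_jump two_pos hQ hφ j),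
            Function.iterate_succ_apply', Function.iterate_succ_apply']
      rw [h2 J _ _ (fun _ => measurable_const)] at h1
      simp only [Finset.sum_range_succ, add_assoc, Function.iterate_succ_apply]
      exact add_le_add le_rfl (h1 t x)
  have hbound (J : ℕ) : jumpSum K N t x ≤
      2⁻¹ * ∑' k, L^[k] 1 t x + (N + 1 : ℕ) * L^[J] 1 t x := by
    calc jumpSum K N t x ≤ jumpSum K (N + 1) t x := by
          rw [jumpSum_succ hK]; exact le_self_add
      _ ≤ _ := hunfold J t x
      _ ≤ _ := by
          refine add_le_add ?_ ?_
          · simp_rw [hiter 2⁻¹ (by simp), ← Finset.mul_sum]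
            gcongr
            exact ENNReal.sum_le_tsum _
          · rw [← congrFun (congrFun (hiter ((N + 1 : ℕ) : ℝ≥0∞) (by simp) J) t) x]
            exact jump_mono.iterate J (fun t x => jumpSum_le hK1 (N + 1) t x) t x
  have hlim2 := (ENNReal.Tendsto.const_mul (a := ((N + 1 : ℕ) : ℝ≥0∞)) hlim
    (Or.inr (by simp))).const_add (2⁻¹ * ∑' k, L^[k] 1 t x)
  rw [mul_zero, add_zero] at hlim2
  exact ge_of_tendsto' hlim2 hbound

/-! ### Weights -/

variable {M : Type}

/-- The weight of the chain that starts from the weight `w₀` and applies at every ring the kernel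
determined by the time and the mark of the ring. -/
noncomputable def weight (κ : ℝ → M → V → V → ℝ≥0) (w₀ : V → ℝ≥0) (c : Clock M) : ℕ → V → ℝ≥0
  | 0 => w₀
  | k + 1 => fun y => ∑ x, weight κ w₀ c k x * κ (elapsed c (k + 1)) (c k).2 x y

theorem weight_congr (κ : ℝ → M → V → V → ℝ≥0) (w₀ : V → ℝ≥0) {c c' : Clock M} {k : ℕ}
    (h : ∀ i < k, c i = c' i) : weight κ w₀ c k = weight κ w₀ c' k := by
  induction k with
  | zero => rfl
  | succ k ih =>
    ext1 y
    simp only [weight]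
    rw [ih fun i hi => h i (by omega), elapsed_congr h, h k (by omega)]

theorem weight_update (κ : ℝ → M → V → V → ℝ≥0) (w₀ : V → ℝ≥0) (c : Clock M) (k : ℕ) (z : ℝ × M) :
    weight κ w₀ (Function.update c k z) k = weight κ w₀ c k :=
  weight_congr κ w₀ fun i hi => Function.update_of_ne (by omega) _ _

variable [MeasurableSpace M]

theorem measurable_weight {κ : ℝ → M → V → V → ℝ≥0}
    (hκ : ∀ x y, Measurable fun z : ℝ × M => κ z.1 z.2 x y) (w₀ : V → ℝ≥0) (k : ℕ) (y : V) :
    Measurable fun c => weight κ w₀ c k y := by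
  induction k generalizing y with
  | zero => exact measurable_const
  | succ k ih =>
    exact Finset.measurable_fun_sum _ fun x _ => (ih x).mul
      ((hκ x y).comp ((measurable_elapsed (k + 1)).prodMk (by fun_prop)))

/-- Duality between pushing weights forward and applying the jump operator backward. Redrawing the
last ring averages the mark, turning `κ` into `K`, and its waiting time, producing one `jump`. The
marks may thus be realised or averaged beforehand, with the same mean. -/
theorem lintegral_weight {ν : Measure M} [IsProbabilityMeasure ν] (hr : 0 < r)
    {κ : ℝ → M → V → V → ℝ≥0}
    (hκ : ∀ x y, Measurable fun z : ℝ × M => κ z.1 z.2 x y)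
    (hK : ∀ x y, Measurable fun t => K t x y)
    (hκK : ∀ t x y, ∫⁻ m, κ t m x y ∂ν = K t x y) (w₀ : V → ℝ≥0) (k : ℕ)
    (hφ : ∀ x, Measurable fun t => φ t x) :
    ∫⁻ c, ∑ y, weight κ w₀ c k y * φ (elapsed c k) y ∂clockLaw r ν =
      ∑ x, w₀ x * (jump r K)^[k] φ 0 x := by
  have := isProbabilityMeasure_clockLaw hr ν
  have := isProbabilityMeasure_expMeasure hr
  induction k generalizing φ with
  | zero => simp [weight]
  | succ k ih =>
    have hm (k : ℕ) : Measurable fun c : Clock M =>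
        ∑ y, (weight κ w₀ c k y : ℝ≥0∞) * φ (elapsed c k) y :=
      Finset.measurable_fun_sum _ fun y _ => (measurable_weight hκ w₀ k y).coe_nnreal_ennreal.mul
        ((hφ y).comp (measurable_elapsed k))
    rw [lintegral_clockLaw_update hr k (hm (k + 1)), Function.iterate_succ_apply,
      ← ih (measurable_jump hr hK hφ)]
    refine lintegral_congr fun c => ?_
    have hm2 (x y : V) : Measurable fun z : ℝ × M =>
        (κ (elapsed c k + z.1) z.2 x y : ℝ≥0∞) * φ (elapsed c k + z.1) y :=
      ((hκ x y).comp ((measurable_fst.const_add _).prodMk measurable_snd)).coe_nnreal_ennreal.mul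
        ((hφ y).comp (measurable_fst.const_add _))
    have e1 (z : ℝ × M) : ∑ y, (weight κ w₀ (Function.update c k z) (k + 1) y : ℝ≥0∞) *
        φ (elapsed (Function.update c k z) (k + 1)) y = ∑ x, (weight κ w₀ c k x : ℝ≥0∞) *
          ∑ y, κ (elapsed c k + z.1) z.2 x y * φ (elapsed c k + z.1) y := by
      simp only [weight, weight_update, elapsed_update_succ, Function.update_self]
      push_cast
      simp_rw [Finset.sum_mul, Finset.mul_sum, mul_assoc]
      exact Finset.sum_comm
    simp_rw [e1]
    rw [lintegral_finsetSum _ fun x _ =>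
      (Finset.measurable_fun_sum _ fun y _ => hm2 x y).const_mul _]
    refine Finset.sum_congr rfl fun x _ => ?_
    rw [lintegral_const_mul' _ _ ENNReal.coe_ne_top,
      lintegral_prod _ (Finset.measurable_fun_sum _ fun y _ => hm2 x y).aemeasurable]
    congr 1
    refine lintegral_congr fun s => ?_
    have h4 (y : V) : Measurable fun m : M =>
        (κ (elapsed c k + s) m x y : ℝ≥0∞) * φ (elapsed c k + s) y :=
      (hm2 x y).comp (measurable_prodMk_left (x := s))
    simp only []
    rw [lintegral_finsetSum _ fun y _ => h4 y]
    refine Finset.sum_congr rfl fun y _ => ?_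
    have h3 : Measurable fun m => (κ (elapsed c k + s) m x y : ℝ≥0∞) :=
      ((hκ x y).comp (measurable_const.prodMk measurable_id)).coe_nnreal_ennreal
    rw [← hκK, ← lintegral_mul_const _ h3]

end Chain

/-! ### The killed walk -/

section Walk

variable {n d : ℕ}

open Classical in
/-- The result of trying to move from `x` in direction `v` in the configuration `ζ`. -/
noncomputable def step (ζ : Config n d) (x : Vertex n d) (v : Direction d) : Vertex n d :=
  if IsOpen ζ x (neighbour x v) then neighbour x v else x

open Classical in
/-- The kernel of the step in direction `v`, killed on `A`. -/
noncomputable def killedStep (A : Set (Vertex n d)) (ζ : Config n d) (v : Direction d)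
    (x y : Vertex n d) : ℝ≥0 :=
  if x ∉ A ∧ step ζ x v ∉ A ∧ step ζ x v = y then 1 else 0

/-- The kernel of the walk killed on `A`. -/
noncomputable def killedKernel (A : Set (Vertex n d)) (ζ : Config n d) (x y : Vertex n d) : ℝ≥0 :=
  (2 * d : ℝ≥0)⁻¹ * ∑ v, killedStep A ζ v x y

theorem positionAfter_succ (η : ℝ≥0 → Config n d) (x : Vertex n d) (c : Clock (Direction d))
    (k : ℕ) : positionAfter η x c (k + 1) =
      step (η (elapsed c (k + 1)).toNNReal) (positionAfter η x c k) (c k).2 := rfl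

theorem card_direction (d : ℕ) : Fintype.card (Direction d) = 2 * d := by
  simp [Direction, mul_comm]

theorem lintegral_uniformOn_direction [NeZero d] (f : Direction d → ℝ≥0∞) :
    ∫⁻ v, f v ∂uniformOn Set.univ = (2 * d : ℝ≥0∞)⁻¹ * ∑ v, f v := by
  rw [lintegral_fintype, Finset.mul_sum]
  refine Finset.sum_congr rfl fun v _ => ?_
  rw [uniformOn_univ, Measure.count_singleton, card_direction]
  push_cast
  rw [mul_comm, one_div]

theorem lintegral_killedStep [NeZero d] (A : Set (Vertex n d)) (ζ : Config n d)
    (x y : Vertex n d) :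
    ∫⁻ v, killedStep A ζ v x y ∂uniformOn Set.univ = killedKernel A ζ x y := by
  rw [lintegral_uniformOn_direction, killedKernel]
  have hd : (2 * d : ℝ≥0) ≠ 0 := by simp [NeZero.ne d]
  push_cast [ENNReal.coe_inv hd]
  rfl

theorem hittingTime_le (A : Set (Vertex n d)) (η : ℝ≥0 → Config n d) (x : Vertex n d)
    {c : Clock (Direction d)} (hc : ∀ i, 0 < (c i).1) {N : ℕ} (hN : positionAfter η x c N ∈ A) :
    hittingTime A (walk η x c) ≤ ENNReal.ofReal (elapsed c N) := by
  have h0 := elapsed_nonneg hc N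
  have hcount : ringCount c (elapsed c N).toNNReal = N := by
    apply ringCount_eq hc
    · rw [Real.coe_toNNReal _ h0]
    · rw [Real.coe_toNNReal _ h0, elapsed_succ]; linarith [hc N]
  refine iInf₂_le (elapsed c N).toNNReal ?_
  rw [walk, hcount]
  exact hN

theorem quenchedHitting_eq_zero [NeZero d] (A : Set (Vertex n d)) (η : ℝ≥0 → Config n d)
    {x : Vertex n d}
    (hx : x ∈ A) : quenchedHitting A x η = 0 := by
  rw [quenchedHitting, lintegral_eq_zero_of_ae_eq_zero]
  filter_upwards [ae_clockLaw_pos (ν := uniformOn (Set.univ : Set (Direction d))) one_pos]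
    with c hc
  simpa using hittingTime_le A η x hc (N := 0) hx

variable [NeZero n]

theorem sum_killedStep_le (A : Set (Vertex n d)) (ζ : Config n d) (v : Direction d)
    (x : Vertex n d) : ∑ y, killedStep A ζ v x y ≤ 1 := by
  classical
  calc ∑ y, killedStep A ζ v x y ≤ ∑ y, if step ζ x v = y then 1 else 0 :=
        Finset.sum_le_sum fun y _ => by unfold killedStep; split_ifs <;> simp_all
    _ = 1 := by simp

theorem sum_killedKernel_le [NeZero d] (A : Set (Vertex n d)) (ζ : Config n d)
    (x : Vertex n d) : ∑ y, killedKernel A ζ x y ≤ 1 := by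
  simp only [killedKernel]
  rw [← Finset.mul_sum, Finset.sum_comm]
  have hd : (2 * d : ℝ≥0) ≠ 0 := by simp [NeZero.ne d]
  calc (2 * d : ℝ≥0)⁻¹ * ∑ v, ∑ y, killedStep A ζ v x y
      ≤ (2 * d : ℝ≥0)⁻¹ * ∑ v : Direction d, 1 := by
        gcongr with v
        exact sum_killedStep_le A ζ v x
    _ = 1 := by
        rw [Finset.sum_const, Finset.card_univ, card_direction]
        simp only [nsmul_eq_mul, mul_one]
        push_cast
        exact inv_mul_cancel₀ hd

theorem measurable_killedStep (A : Set (Vertex n d)) {η : ℝ≥0 → Config n d} (hη : Measurable η)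
    (x y : Vertex n d) :
    Measurable fun z : ℝ × Direction d => killedStep A (η z.1.toNNReal) z.2 x y := by
  have h : Measurable fun w : Config n d × Direction d => killedStep A w.1 w.2 x y :=
    measurable_of_finite _
  have h2 : Measurable fun z : ℝ × Direction d => (η z.1.toNNReal, z.2) :=
    (hη.comp (measurable_real_toNNReal.comp measurable_fst)).prodMk measurable_snd
  have h3 := h.comp h2
  exact h3

theorem measurable_killedKernel (A : Set (Vertex n d)) {η : ℝ≥0 → Config n d} (hη : Measurable η)
    (x y : Vertex n d) : Measurable fun t : ℝ => killedKernel A (η t.toNNReal) x y := by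
  have h : Measurable fun w : Config n d => killedKernel A w x y := measurable_of_finite _
  exact h.comp (hη.comp measurable_real_toNNReal)

/-- The weight of the killed walk is the indicator function of its position. -/
theorem weight_killedStep (A : Set (Vertex n d)) (η : ℝ≥0 → Config n d) {x : Vertex n d}
    (hx : x ∉ A) (c : Clock (Direction d)) (k : ℕ) :
    weight (fun t v => killedStep A (η t.toNNReal) v) (Pi.single x 1) c k =
      open Classical in if ∀ j ≤ k, positionAfter η x c j ∉ A
        then Pi.single (positionAfter η x c k) 1 else 0 := by
  classical
  induction k with
  | zero => simp [weight, positionAfter, hx]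
  | succ k ih =>
    ext1 y
    simp only [weight]
    rw [ih]
    by_cases h : ∀ j ≤ k, positionAfter η x c j ∉ A
    · rw [if_pos h, Finset.sum_eq_single (positionAfter η x c k)]
      · have hk := h k le_rfl
        simp only [Pi.single_eq_same, one_mul, killedStep, ← positionAfter_succ, hk,
          not_false_eq_true, true_and]
        by_cases h' : positionAfter η x c (k + 1) ∈ A
        · rw [if_neg (by simp [h']), if_neg fun H => H (k + 1) le_rfl h', Pi.zero_apply]
        · have : ∀ j ≤ k + 1, positionAfter η x c j ∉ A := fun j hj => by
            rcases hj.lt_or_eq with hj | rfl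
            · exact h j (by omega)
            · exact h'
          rw [if_pos this, Pi.single_apply]
          simp [h', eq_comm]
      · intro b _ hb
        simp [Pi.single_eq_of_ne hb]
      · simp
    · rw [if_neg h, if_neg fun H => h fun j hj => H j (by omega)]
      simp

/-- The hitting time is at most the sum of the waiting times that begin while the walk is still
alive. Survival through $k$ rings does not involve waiting time number $k$, which has mean one and
can therefore be dropped from the expectation. -/
theorem quenchedHitting_le_tsum_weight [NeZero d] (A : Set (Vertex n d)) {η : ℝ≥0 → Config n d}
    (hη : Measurable η) {x : Vertex n d} (hx : x ∉ A) :
    quenchedHitting A x η ≤ ∑' k, ∫⁻ c, ∑ y,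
      weight (fun t v => killedStep A (η t.toNNReal) v) (Pi.single x 1) c k y * 1
        ∂walkNoise d := by
  classical
  set κ : ℝ → Direction d → Vertex n d → Vertex n d → ℝ≥0 :=
    fun t v => killedStep A (η t.toNNReal) v with hκ
  let S (k : ℕ) (c : Clock (Direction d)) : ℝ≥0∞ := ∑ y, weight κ (Pi.single x 1) c k y * 1
  have hprob : IsProbabilityMeasure (walkNoise d) := isProbabilityMeasure_walkNoise d
  have hexp := isProbabilityMeasure_expMeasure one_pos
  have hS (k : ℕ) : Measurable (S k) :=
    Finset.measurable_fun_sum _ fun y _ =>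
      (measurable_weight (measurable_killedStep A hη) _ k y).coe_nnreal_ennreal.mul_const _
  have hSval (k : ℕ) (c : Clock (Direction d)) :
      S k c = if ∀ j ≤ k, positionAfter η x c j ∉ A then 1 else 0 := by
    simp only [S, hκ, weight_killedStep A η hx]
    split_ifs
    · simp [Pi.single_apply, apply_ite]
    · simp
  change _ ≤ ∑' k, ∫⁻ c, S k c ∂walkNoise d
  have hwait (k : ℕ) :
      ∫⁻ c, S k c ∂walkNoise d = ∫⁻ c, S k c * ENNReal.ofReal (c k).1 ∂walkNoise d := by
    rw [walkNoise, lintegral_clockLaw_update one_pos k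
      (f := fun c => S k c * ENNReal.ofReal (c k).1) ((hS k).mul (by fun_prop))]
    refine lintegral_congr fun c => ?_
    simp only [S, weight_update, Function.update_self]
    rw [lintegral_const_mul _ (by fun_prop), lintegral_prod _ (by fun_prop)]
    simp [lintegral_id_expMeasure_one]
  by_cases htop : ∑' k, ∫⁻ c, S k c ∂walkNoise d = ∞
  · rw [htop]; exact le_top
  have hae : ∀ᵐ c ∂walkNoise d, ∑' k, S k c < ∞ := by
    refine ae_lt_top (Measurable.tsum hS) ?_
    rwa [lintegral_tsum fun k => (hS k).aemeasurable]
  simp_rw [hwait]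
  have hSw (k : ℕ) : Measurable fun c : Clock (Direction d) => S k c * ENNReal.ofReal (c k).1 :=
    (hS k).mul (by fun_prop)
  rw [← lintegral_tsum fun k => (hSw k).aemeasurable]
  refine lintegral_mono_ae ?_
  filter_upwards [hae, ae_clockLaw_pos (ν := uniformOn (Set.univ : Set (Direction d))) one_pos]
    with c hc hpos
  -- A path that avoids $A$ forever would contribute $1$ for every $k$, against the almost sure
  -- finiteness of the sum.
  have hex : ∃ N, positionAfter η x c N ∈ A := by
    by_contra! h
    have h1 (k : ℕ) : S k c = 1 := by rw [hSval, if_pos fun j _ => h j]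
    simp [h1] at hc
  refine (hittingTime_le A η x hpos (Nat.find_spec hex)).trans ?_
  rw [elapsed, ENNReal.ofReal_sum_of_nonneg fun i _ => (hpos i).le]
  refine (Finset.sum_le_sum fun k hk => ?_).trans
    (ENNReal.sum_le_tsum (Finset.range (Nat.find hex)))
  rw [hSval, if_pos, one_mul]
  intro j hj
  exact Nat.find_min hex (hj.trans_lt (Finset.mem_range.1 hk))

/-- The weight at ring number `k` of the lazy rate `2` walk killed on `A`, in the environment `η`
and with the waiting times `ξ`. -/
noncomputable def lazyWeight (A : Set (Vertex n d)) (η : ℝ≥0 → Config n d) (x : Vertex n d)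
    (ξ : Clock Unit) (k : ℕ) : Vertex n d → ℝ≥0 :=
  open Classical in
  weight (fun t _ => lazyKernel (fun t => killedKernel A (η t.toNNReal)) t) (Pi.single x 1) ξ k

/-- The law of a rate `2` clock without marks. -/
noncomputable def lazyNoise : Measure (Clock Unit) := clockLaw 2 (Measure.dirac ())

instance : IsProbabilityMeasure lazyNoise := isProbabilityMeasure_clockLaw two_pos _

/-- `lintegral_weight` is used twice: with direction marks for the actual walk, and with trivial
marks for the lazy one, where directions are averaged but ring times kept. The time-inhomogeneous
comparison `tsum_iterate_jump_le` joins the two. -/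
theorem quenchedHitting_le [NeZero d] (A : Set (Vertex n d)) {η : ℝ≥0 → Config n d}
    (hη : Measurable η) {x : Vertex n d} (hx : x ∉ A) :
    quenchedHitting A x η ≤ 2⁻¹ * ∑' k, ∫⁻ ξ, ∑ y, (lazyWeight A η x ξ k y : ℝ≥0∞) ∂lazyNoise := by
  classical
  have hK := measurable_killedKernel A hη
  have hQ := measurable_lazyKernel hK
  have hone (x : Vertex n d) : Measurable fun t : ℝ => (1 : ℝ → Vertex n d → ℝ≥0∞) t x :=
    measurable_const
  have hsingle (f : Vertex n d → ℝ≥0∞) :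
      ∑ z, ((Pi.single x 1 : Vertex n d → ℝ≥0) z : ℝ≥0∞) * f z = f x := by
    simp [Pi.single_apply, apply_ite]
  have h1 (k : ℕ) := lintegral_weight (ν := uniformOn (Set.univ : Set (Direction d))) one_pos
    (measurable_killedStep A hη) hK (fun t x y => lintegral_killedStep A _ x y)
    (Pi.single x 1) k hone
  have h2 (k : ℕ) := lintegral_weight (ν := Measure.dirac ()) two_pos
    (κ := fun t (_ : Unit) => lazyKernel (fun t => killedKernel A (η t.toNNReal)) t)
    (fun x y => (hQ x y).comp measurable_fst) hQ (fun t x y => by simp) (Pi.single x 1) k hone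
  refine (quenchedHitting_le_tsum_weight A hη hx).trans ?_
  have h3 := tsum_iterate_jump_le hK (fun t x => sum_killedKernel_le A _ x) 0 x
  simp only [hsingle] at h1 h2
  simp_rw [← h1, ← h2] at h3
  simpa [lazyWeight, lazyNoise, walkNoise] using h3

end Walk

/-! ### Symmetry and dissipation -/

section Dissipation

variable {n d : ℕ}

/-- The opposite direction. -/
def opposite (v : Direction d) : Direction d := (v.1, !v.2)

@[simp] theorem opposite_opposite (v : Direction d) : opposite (opposite v) = v := by
  simp [opposite]

@[simp] theorem neighbour_opposite (x : Vertex n d) (v : Direction d) :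
    neighbour (neighbour x v) (opposite v) = x := by
  obtain ⟨i, b⟩ := v
  cases b <;> simp [neighbour, opposite, add_assoc, ← Pi.single_add]

theorem IsOpen.symm {ζ : Config n d} {x y : Vertex n d} (h : IsOpen ζ x y) : IsOpen ζ y x := by
  unfold IsOpen at *
  rwa [Sym2.eq_swap]

open Classical in
/-- The direction that undoes a step. -/
noncomputable def undo (ζ : Config n d) (x : Vertex n d) (v : Direction d) : Direction d :=
  if IsOpen ζ x (neighbour x v) then opposite v else v

theorem step_undo (ζ : Config n d) (x : Vertex n d) (v : Direction d) :
    step ζ (step ζ x v) (undo ζ x v) = x := by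
  by_cases h : IsOpen ζ x (neighbour x v)
  · rw [show step ζ x v = neighbour x v from if_pos h, show undo ζ x v = opposite v from if_pos h,
      step, neighbour_opposite, if_pos h.symm]
  · rw [show step ζ x v = x from if_neg h, show undo ζ x v = v from if_neg h, step, if_neg h]

theorem undo_undo (ζ : Config n d) (x : Vertex n d) (v : Direction d) :
    undo ζ (step ζ x v) (undo ζ x v) = v := by
  by_cases h : IsOpen ζ x (neighbour x v)
  · rw [show step ζ x v = neighbour x v from if_pos h, show undo ζ x v = opposite v from if_pos h,
      undo, neighbour_opposite, if_pos h.symm, opposite_opposite]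
  · rw [show step ζ x v = x from if_neg h, show undo ζ x v = v from if_neg h, undo, if_neg h]

/-- Undoing steps permutes the pairs of a position and a direction. -/
noncomputable def undoPerm (ζ : Config n d) : Equiv.Perm (Vertex n d × Direction d) :=
  Function.Involutive.toPerm (fun z => (step ζ z.1 z.2, undo ζ z.1 z.2)) fun z =>
    Prod.ext (step_undo ζ z.1 z.2) (undo_undo ζ z.1 z.2)

variable [NeZero n]

/-- Detailed balance for counting measure: relabel the pairs of a position and a direction by
`undoPerm`. Counting directions rather than edges keeps this valid when $e_i$ and $-e_i$ lead to the
same vertex. -/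
theorem sum_step {R : Type*} [AddCommMonoid R] (ζ : Config n d)
    (f : Vertex n d → Vertex n d → R) :
    ∑ x, ∑ v, f x (step ζ x v) = ∑ x, ∑ v, f (step ζ x v) x := by
  rw [← Fintype.sum_prod_type' fun x v => f x (step ζ x v),
    ← Fintype.sum_prod_type' fun x v => f (step ζ x v) x]
  rw [← Equiv.sum_comp (undoPerm ζ)]
  refine Finset.sum_congr rfl fun z _ => ?_
  change f (step ζ z.1 z.2) (step ζ (step ζ z.1 z.2) (undo ζ z.1 z.2)) = _
  rw [step_undo]

theorem killedKernel_symm (A : Set (Vertex n d)) (ζ : Config n d) (x y : Vertex n d) :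
    killedKernel A ζ x y = killedKernel A ζ y x := by
  classical
  have h := sum_step ζ fun a b => if a = x ∧ b = y ∧ x ∉ A ∧ y ∉ A then (1 : ℝ≥0) else 0
  have e (x y : Vertex n d) : ∑ v, killedStep A ζ v x y =
      ∑ a, ∑ v, if a = x ∧ step ζ a v = y ∧ x ∉ A ∧ y ∉ A then (1 : ℝ≥0) else 0 := by
    rw [Finset.sum_eq_single x (fun b _ hb => by simp [hb]) (by simp)]
    refine Finset.sum_congr rfl fun v _ => ?_
    unfold killedStep
    congr 1
    apply propext
    constructor
    · rintro ⟨h1, h2, h3⟩; exact ⟨rfl, h3, h1, h3 ▸ h2⟩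
    · rintro ⟨-, h3, h1, h2⟩; exact ⟨h1, h3 ▸ h2, h3⟩
  rw [killedKernel, killedKernel, e, e, h]
  congr 1
  refine Finset.sum_congr rfl fun a _ => Finset.sum_congr rfl fun v _ => ?_
  congr 1
  apply propext
  tauto

/-- One lazy step of the killed walk, applied to a weight. -/
noncomputable def evolve (A : Set (Vertex n d)) (ζ : Config n d) (u : Vertex n d → ℝ≥0) :
    Vertex n d → ℝ≥0 :=
  fun y => ∑ x, u x * (2⁻¹ * ((open Classical in if x = y then 1 else 0) + killedKernel A ζ x y))

theorem lazyWeight_succ (A : Set (Vertex n d)) (η : ℝ≥0 → Config n d) (x : Vertex n d)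
    (ξ : Clock Unit) (k : ℕ) :
    lazyWeight A η x ξ (k + 1) =
      evolve A (η (elapsed ξ (k + 1)).toNNReal) (lazyWeight A η x ξ k) := rfl

theorem evolve_eq (A : Set (Vertex n d)) (ζ : Config n d) (u : Vertex n d → ℝ≥0)
    (y : Vertex n d) :
    evolve A ζ u y = 2⁻¹ * (u y + ∑ x, u x * killedKernel A ζ y x) := by
  classical
  unfold evolve
  simp_rw [killedKernel_symm A ζ _ y]
  rw [mul_add, Finset.mul_sum]
  simp_rw [mul_add]
  rw [Finset.sum_add_distrib]
  congr 1
  · simp [mul_comm]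
  · exact Finset.sum_congr rfl fun x _ => by ring

theorem evolve_apply_mem {A : Set (Vertex n d)} (ζ : Config n d) {u : Vertex n d → ℝ≥0}
    (hu : ∀ x ∈ A, u x = 0) {y : Vertex n d} (hy : y ∈ A) : evolve A ζ u y = 0 := by
  rw [evolve_eq, hu y hy]
  simp [killedKernel, killedStep, hy]

theorem sum_evolve_le [NeZero d] (A : Set (Vertex n d)) (ζ : Config n d)
    (u : Vertex n d → ℝ≥0) : ∑ y, evolve A ζ u y ≤ ∑ y, u y := by
  classical
  unfold evolve
  rw [Finset.sum_comm]
  refine Finset.sum_le_sum fun x _ => ?_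
  rw [← Finset.mul_sum, ← Finset.mul_sum, Finset.sum_add_distrib]
  have h := sum_killedKernel_le A ζ x
  have h2 : ∑ y, (if x = y then (1 : ℝ≥0) else 0) = 1 := by simp
  calc u x * (2⁻¹ * (∑ y, (if x = y then (1 : ℝ≥0) else 0) + ∑ y, killedKernel A ζ x y))
      ≤ u x * (2⁻¹ * (1 + 1)) := by rw [h2]; gcongr
    _ = u x := by norm_num

/-- By symmetry the new weight at $y$ is read off from the steps leaving $y$, and killing only
removes nonnegative terms. -/
theorem evolve_le_average [NeZero d] {A : Set (Vertex n d)} (ζ : Config n d)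
    {u : Vertex n d → ℝ≥0} (y : Vertex n d) :
    (evolve A ζ u y : ℝ) ≤ (2 * d : ℝ)⁻¹ * ∑ v, ((u y : ℝ) + u (step ζ y v)) / 2 := by
  classical
  have hd : (2 * d : ℝ) ≠ 0 := by simp [NeZero.ne d]
  have h1 : ∑ x, u x * killedKernel A ζ y x ≤ (2 * d : ℝ≥0)⁻¹ * ∑ v, u (step ζ y v) := by
    simp only [killedKernel, Finset.mul_sum]
    rw [Finset.sum_comm]
    refine Finset.sum_le_sum fun v _ => ?_
    calc ∑ x, u x * ((2 * d : ℝ≥0)⁻¹ * killedStep A ζ v y x)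
        ≤ ∑ x, if step ζ y v = x then (2 * d : ℝ≥0)⁻¹ * u x else 0 := by
          refine Finset.sum_le_sum fun x _ => ?_
          unfold killedStep
          split_ifs <;> simp_all [mul_comm]
      _ = _ := by simp
  have h2 : (∑ x, u x * killedKernel A ζ y x : ℝ) ≤
      (2 * d : ℝ)⁻¹ * ∑ v, (u (step ζ y v) : ℝ) := by exact_mod_cast h1
  have h3 : (2 * d : ℝ)⁻¹ * ∑ _v : Direction d, (u y : ℝ) = u y := by
    rw [Finset.sum_const, Finset.card_univ, card_direction, nsmul_eq_mul]
    push_cast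
    rw [← mul_assoc, inv_mul_cancel₀ hd, one_mul]
  rw [evolve_eq]
  push_cast
  rw [← Finset.sum_div, Finset.sum_add_distrib, mul_div_assoc', mul_add, mul_add, h3]
  linarith

/-- Apply Cauchy–Schwarz to the average over directions, then
$\left(\frac{a+b}{2}\right)^2+\frac{(a-b)^2}{4}=\frac{a^2+b^2}{2}$; `sum_step` makes both squares on
the right sum to $2d\|u\|_2^2$. Laziness is what puts $u(y)$ into each average and so produces the
gradient; the constant is $\frac14\cdot\frac1{2d}$. -/
theorem dissipation_step [NeZero d] {A : Set (Vertex n d)} (ζ : Config n d)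
    (u : Vertex n d → ℝ≥0) :
    ∑ y, (evolve A ζ u y : ℝ) ^ 2 +
      (8 * d : ℝ)⁻¹ * ∑ y, ∑ v, ((u (step ζ y v) : ℝ) - u y) ^ 2 ≤ ∑ y, (u y : ℝ) ^ 2 := by
  have hd : (0 : ℝ) < d := by exact_mod_cast NeZero.pos d
  have hcard : ((Finset.univ : Finset (Direction d)).card : ℝ) = 2 * d := by
    rw [Finset.card_univ, card_direction]; push_cast; ring
  have h1 (y : Vertex n d) : (evolve A ζ u y : ℝ) ^ 2 ≤
      (2 * d : ℝ)⁻¹ * ∑ v, (((u y : ℝ) + u (step ζ y v)) / 2) ^ 2 := by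
    have h := pow_le_pow_left₀ (evolve A ζ u y).2 (evolve_le_average (A := A) ζ (u := u) y) 2
    refine h.trans ?_
    have hc := sq_sum_le_card_mul_sum_sq (s := Finset.univ)
      (f := fun v : Direction d => ((u y : ℝ) + u (step ζ y v)) / 2)
    rw [hcard] at hc
    calc _ = ((2 * d : ℝ)⁻¹) ^ 2 * (∑ v, ((u y : ℝ) + u (step ζ y v)) / 2) ^ 2 := by ring
      _ ≤ ((2 * d : ℝ)⁻¹) ^ 2 * (2 * d * ∑ v, (((u y : ℝ) + u (step ζ y v)) / 2) ^ 2) := by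
        gcongr
      _ = _ := by field_simp
  have h2 : ∑ y, ∑ v, (u (step ζ y v) : ℝ) ^ 2 = 2 * d * ∑ y, (u y : ℝ) ^ 2 := by
    rw [sum_step ζ fun _ b => (u b : ℝ) ^ 2, Finset.mul_sum]
    refine Finset.sum_congr rfl fun y _ => ?_
    rw [Finset.sum_const, nsmul_eq_mul, hcard]
  have h2' : ∑ y, ∑ _v : Direction d, (u y : ℝ) ^ 2 = 2 * d * ∑ y, (u y : ℝ) ^ 2 := by
    rw [Finset.mul_sum]
    refine Finset.sum_congr rfl fun y _ => ?_
    rw [Finset.sum_const, nsmul_eq_mul, hcard]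
  have h3 : ∑ y, ∑ v, (((u y : ℝ) + u (step ζ y v)) / 2) ^ 2 +
      4⁻¹ * ∑ y, ∑ v, ((u (step ζ y v) : ℝ) - u y) ^ 2 = 2 * d * ∑ y, (u y : ℝ) ^ 2 := by
    have : ∑ y, ∑ v, (((u y : ℝ) + u (step ζ y v)) / 2) ^ 2 +
        4⁻¹ * ∑ y, ∑ v, ((u (step ζ y v) : ℝ) - u y) ^ 2 =
        2⁻¹ * ∑ y, ∑ _v : Direction d, (u y : ℝ) ^ 2 +
          2⁻¹ * ∑ y, ∑ v, (u (step ζ y v) : ℝ) ^ 2 := by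
      simp only [Finset.mul_sum, ← Finset.sum_add_distrib]
      exact Finset.sum_congr rfl fun y _ => Finset.sum_congr rfl fun v _ => by ring
    rw [this, h2, h2']; ring
  have h4 : ∑ y, (evolve A ζ u y : ℝ) ^ 2 ≤
      (2 * d : ℝ)⁻¹ * ∑ y, ∑ v, (((u y : ℝ) + u (step ζ y v)) / 2) ^ 2 := by
    rw [Finset.mul_sum]
    exact Finset.sum_le_sum fun y _ => h1 y
  have h5 : ∑ y, ∑ v, (((u y : ℝ) + u (step ζ y v)) / 2) ^ 2 = 2 * d * ∑ y, (u y : ℝ) ^ 2 -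
      4⁻¹ * ∑ y, ∑ v, ((u (step ζ y v) : ℝ) - u y) ^ 2 := by linarith
  rw [h5] at h4
  have h6 : (2 * d : ℝ)⁻¹ * (2 * d * ∑ y, (u y : ℝ) ^ 2 -
      4⁻¹ * ∑ y, ∑ v, ((u (step ζ y v) : ℝ) - u y) ^ 2) = ∑ y, (u y : ℝ) ^ 2 -
        (8 * d : ℝ)⁻¹ * ∑ y, ∑ v, ((u (step ζ y v) : ℝ) - u y) ^ 2 := by
    field_simp
    ring
  linarith

open Classical in
/-- A lazy step dissipates energy along the open edges. -/
theorem dissipation [NeZero d] {A : Set (Vertex n d)} (ζ : Config n d) (u : Vertex n d → ℝ≥0) :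
    ∑ y, (evolve A ζ u y : ℝ) ^ 2 + (8 * d : ℝ)⁻¹ * ∑ y, ∑ i,
      (if IsOpen ζ y (y + Pi.single i 1) then ((u (y + Pi.single i 1) : ℝ) - u y) ^ 2 else 0) ≤
        ∑ y, (u y : ℝ) ^ 2 := by
  refine le_trans ?_ (dissipation_step (A := A) ζ u)
  gcongr with y
  rw [Fintype.sum_prod_type]
  refine Finset.sum_le_sum fun i _ => ?_
  rw [Fintype.sum_bool]
  refine le_trans (le_of_eq ?_) (le_add_of_nonneg_right (sq_nonneg _))
  simp only [step, neighbour, if_true]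
  split_ifs <;> simp

end Dissipation

/-! ### Poincaré and Nash inequalities -/

section Shift

variable {G : Type*} [AddCommGroup G] [Fintype G]

/-- The `ℓ²` norm of the difference of a function and its translate. -/
noncomputable def shiftNorm (u : G → ℝ) (w : G) : ℝ := √(∑ x, (u (x + w) - u x) ^ 2)

theorem sq_shiftNorm (u : G → ℝ) (w : G) : shiftNorm u w ^ 2 = ∑ x, (u (x + w) - u x) ^ 2 :=
  Real.sq_sqrt (Finset.sum_nonneg fun _ _ => sq_nonneg _)

theorem shiftNorm_nonneg (u : G → ℝ) (w : G) : 0 ≤ shiftNorm u w := Real.sqrt_nonneg _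

@[simp] theorem shiftNorm_zero (u : G → ℝ) : shiftNorm u 0 = 0 := by simp [shiftNorm]

theorem shiftNorm_add_le (u : G → ℝ) (a b : G) :
    shiftNorm u (a + b) ≤ shiftNorm u a + shiftNorm u b := by
  let f : EuclideanSpace ℝ G := WithLp.toLp 2 fun x => u (x + a + b) - u (x + a)
  let g : EuclideanSpace ℝ G := WithLp.toLp 2 fun x => u (x + a) - u x
  have h := norm_add_le f g
  have hf : ‖f‖ = shiftNorm u b := by
    rw [EuclideanSpace.norm_eq, shiftNorm]
    simp only [f, Real.norm_eq_abs, sq_abs]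
    rw [← Equiv.sum_comp (Equiv.addRight a) fun x => (u (x + b) - u x) ^ 2]
    rfl
  have hg : ‖g‖ = shiftNorm u a := by
    rw [EuclideanSpace.norm_eq, shiftNorm]
    simp only [g, Real.norm_eq_abs, sq_abs]
  have hfg : ‖f + g‖ = shiftNorm u (a + b) := by
    rw [EuclideanSpace.norm_eq, shiftNorm]
    simp [f, g, Real.norm_eq_abs, sq_abs, add_assoc]
  linarith

theorem shiftNorm_nsmul_le (u : G → ℝ) (m : ℕ) (a : G) :
    shiftNorm u (m • a) ≤ m * shiftNorm u a := by
  induction m with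
  | zero => simp
  | succ m ih =>
    rw [succ_nsmul]
    refine (shiftNorm_add_le u _ _).trans ?_
    push_cast
    linarith

end Shift

/-! ### Energy inequalities on the torus -/

section Torus

variable {n d : ℕ} [NeZero n]

/-- The Dirichlet energy of the torus. -/
noncomputable def energy (u : Vertex n d → ℝ) : ℝ :=
  ∑ i, ∑ x, (u (x + Pi.single i 1) - u x) ^ 2

theorem energy_nonneg (u : Vertex n d → ℝ) : 0 ≤ energy u :=
  Finset.sum_nonneg fun _ _ => Finset.sum_nonneg fun _ _ => sq_nonneg _

/-- Decompose the translation into at most $r$ unit steps along each axis, use the triangle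
inequality for `shiftNorm`, then Cauchy–Schwarz over the $d$ axes. -/
theorem sum_sq_shift_le (u : Vertex n d → ℝ) (r : ℕ) {m : Fin d → ℕ} (hm : ∀ i, m i ≤ r) :
    ∑ x, (u (x + fun i => (m i : ZMod n)) - u x) ^ 2 ≤ d * r ^ 2 * energy u := by
  have hw : (fun i => (m i : ZMod n)) = ∑ i, m i • (Pi.single i 1 : Vertex n d) := by
    ext j
    simp [Finset.sum_apply, Pi.single_apply]
  have h1 : shiftNorm u (fun i => (m i : ZMod n)) ≤
      r * ∑ i, shiftNorm u (Pi.single i 1 : Vertex n d) := by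
    rw [hw, Finset.mul_sum]
    refine (Finset.le_sum_of_subadditive (shiftNorm u) (shiftNorm_zero u).le
      (shiftNorm_add_le u) _ _).trans (Finset.sum_le_sum fun i _ => ?_)
    refine (shiftNorm_nsmul_le u _ _).trans ?_
    exact mul_le_mul_of_nonneg_right (by exact_mod_cast hm i) (shiftNorm_nonneg _ _)
  rw [← sq_shiftNorm]
  refine (pow_le_pow_left₀ (shiftNorm_nonneg _ _) h1 2).trans ?_
  have h2 := sq_sum_le_card_mul_sum_sq (s := Finset.univ)
    (f := fun i : Fin d => shiftNorm u (Pi.single i 1 : Vertex n d))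
  simp only [Finset.card_univ, Fintype.card_fin, sq_shiftNorm] at h2
  rw [mul_pow, mul_comm (d : ℝ), mul_assoc]
  gcongr
  exact h2

/-- Poincaré inequality: sum $(u(y)-u(x))^2$ over all pairs. Translation bounds give at most
$n^d\cdot dn^2$ times the energy; the pairs with one point in $A$ already give $2|A|\,\|u\|_2^2\ge
n^d\|u\|_2^2$. -/
theorem sum_sq_le_energy {A : Finset (Vertex n d)} (hA : (n : ℝ) ^ d / 2 ≤ A.card)
    {u : Vertex n d → ℝ} (hu : ∀ x ∈ A, u x = 0) :
    ∑ x, u x ^ 2 ≤ d * n ^ 2 * energy u := by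
  have hn : (0 : ℝ) < n := by exact_mod_cast NeZero.pos n
  have h1 : ∑ w : Vertex n d, ∑ x, (u (x + w) - u x) ^ 2 ≤
      ∑ _w : Vertex n d, (d * n ^ 2 * energy u : ℝ) := by
    refine Finset.sum_le_sum fun w _ => ?_
    have := sum_sq_shift_le u n (m := fun i => (w i).val) fun i => (ZMod.val_lt _).le
    simpa using this
  have hcard : (Fintype.card (Vertex n d) : ℝ) = n ^ d := by simp [ZMod.card]
  rw [Finset.sum_const, Finset.card_univ, nsmul_eq_mul, hcard, Finset.sum_comm] at h1
  have h2 (x : Vertex n d) : ∑ w, (u (x + w) - u x) ^ 2 = ∑ y, (u y - u x) ^ 2 :=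
    Equiv.sum_comp (Equiv.addLeft x) fun y => (u y - u x) ^ 2
  simp_rw [h2] at h1
  have h3 : 2 * (A.card : ℝ) * ∑ x, u x ^ 2 ≤ ∑ x, ∑ y, (u y - u x) ^ 2 := by
    classical
    have e1 : ∑ x ∈ A, ∑ y, (u y - u x) ^ 2 = A.card * ∑ y, u y ^ 2 := by
      rw [← nsmul_eq_mul, ← Finset.sum_const]
      refine Finset.sum_congr rfl fun x hx => ?_
      simp [hu x hx]
    have e2 : A.card * ∑ y, u y ^ 2 = ∑ x ∈ Aᶜ, (A.card * u x ^ 2 : ℝ) := by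
      rw [← Finset.mul_sum, ← Finset.sum_compl_add_sum A, Finset.sum_eq_zero (s := A), add_zero]
      intro x hx
      simp [hu x hx]
    have e3 : ∑ x ∈ Aᶜ, (A.card * u x ^ 2 : ℝ) ≤ ∑ x ∈ Aᶜ, ∑ y, (u y - u x) ^ 2 := by
      refine Finset.sum_le_sum fun x _ => ?_
      calc (A.card * u x ^ 2 : ℝ) = ∑ y ∈ A, (u y - u x) ^ 2 := by
            rw [← nsmul_eq_mul, ← Finset.sum_const]
            exact Finset.sum_congr rfl fun y hy => by simp [hu y hy]
        _ ≤ _ := Finset.sum_le_sum_of_subset_of_nonneg (Finset.subset_univ _)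
            fun _ _ _ => sq_nonneg _
    rw [← Finset.sum_compl_add_sum A fun x => ∑ y, (u y - u x) ^ 2, e1]
    linarith
  have h4 : (n : ℝ) ^ d * ∑ x, u x ^ 2 ≤ 2 * (A.card : ℝ) * ∑ x, u x ^ 2 := by
    refine mul_le_mul_of_nonneg_right (by linarith) (Finset.sum_nonneg fun _ _ => sq_nonneg _)
  exact le_of_mul_le_mul_left (h4.trans (h3.trans h1)) (by positivity)

/-- Nash inequality at scale $r$: compare $u$ with its average $a$ over boxes of side $r$. The
difference is controlled by translations, and $a\le r^{-d}$ pointwise with total mass at most $1$.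
The box embeds in the torus because $r\le n$. Keeping $r$ free, instead of optimising it, leaves a
bound linear in $\|u\|_2^2$ and the energy. -/
theorem sum_sq_le_energy_add {u : Vertex n d → ℝ} (hu : ∀ x, 0 ≤ u x) (hu1 : ∑ x, u x ≤ 1)
    {r : ℕ} (hr : 0 < r) (hrn : r ≤ n) :
    ∑ x, u x ^ 2 ≤ 2 * (d * r ^ 2 * energy u) + 2 * ((r : ℝ) ^ d)⁻¹ := by
  let ι : (Fin d → Fin r) → Vertex n d := fun v i => ((v i : ℕ) : ZMod n)
  have hι : Function.Injective ι := by
    intro v w h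
    ext i
    have h1 := congrFun h i
    simp only [ι] at h1
    rw [ZMod.natCast_eq_natCast_iff', Nat.mod_eq_of_lt ((v i).2.trans_le hrn),
      Nat.mod_eq_of_lt ((w i).2.trans_le hrn)] at h1
    exact h1
  have hrd : (0 : ℝ) < (r : ℝ) ^ d := by positivity
  have hcard : ((Finset.univ : Finset (Fin d → Fin r)).card : ℝ) = r ^ d := by simp
  let a : Vertex n d → ℝ := fun x => ((r : ℝ) ^ d)⁻¹ * ∑ v, u (x + ι v)
  have ha0 (x) : 0 ≤ a x := mul_nonneg (by positivity) (Finset.sum_nonneg fun _ _ => hu _)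
  have ha1 (x) : a x ≤ ((r : ℝ) ^ d)⁻¹ := by
    have : ∑ v, u (x + ι v) ≤ ∑ y, u y := by
      classical
      rw [← Finset.sum_image (f := u) (g := fun v => x + ι v) (s := Finset.univ)
        (fun v _ w _ h => hι (add_left_cancel h))]
      exact Finset.sum_le_sum_of_subset_of_nonneg (Finset.subset_univ _) fun _ _ _ => hu _
    calc a x ≤ ((r : ℝ) ^ d)⁻¹ * 1 := by
          refine mul_le_mul_of_nonneg_left (this.trans hu1) (by positivity)
      _ = _ := mul_one _
  have hasum : ∑ x, a x ≤ 1 := by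
    simp only [a]
    rw [← Finset.mul_sum, Finset.sum_comm]
    have (v : Fin d → Fin r) : ∑ x, u (x + ι v) = ∑ x, u x :=
      Equiv.sum_comp (Equiv.addRight (ι v)) u
    simp_rw [this]
    rw [Finset.sum_const, nsmul_eq_mul, hcard, ← mul_assoc, inv_mul_cancel₀ hrd.ne', one_mul]
    exact hu1
  have hasq : ∑ x, a x ^ 2 ≤ ((r : ℝ) ^ d)⁻¹ := by
    calc ∑ x, a x ^ 2 ≤ ∑ x, ((r : ℝ) ^ d)⁻¹ * a x := Finset.sum_le_sum fun x _ => by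
          rw [sq]; exact mul_le_mul_of_nonneg_right (ha1 x) (ha0 x)
      _ ≤ ((r : ℝ) ^ d)⁻¹ * 1 := by rw [← Finset.mul_sum]; gcongr
      _ = _ := mul_one _
  have hdiff : ∑ x, (u x - a x) ^ 2 ≤ d * r ^ 2 * energy u := by
    have h1 (x) : (u x - a x) ^ 2 ≤ ((r : ℝ) ^ d)⁻¹ * ∑ v, (u (x + ι v) - u x) ^ 2 := by
      have hc := sq_sum_le_card_mul_sum_sq (s := Finset.univ)
        (f := fun v => u (x + ι v) - u x)
      rw [hcard] at hc
      have : u x - a x = -(((r : ℝ) ^ d)⁻¹ * ∑ v, (u (x + ι v) - u x)) := by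
        rw [Finset.sum_sub_distrib, Finset.sum_const, nsmul_eq_mul, hcard, mul_sub, ← mul_assoc,
          inv_mul_cancel₀ hrd.ne']
        simp only [a]; ring
      rw [this, neg_sq, mul_pow]
      calc _ ≤ (((r : ℝ) ^ d)⁻¹) ^ 2 * ((r : ℝ) ^ d * ∑ v, (u (x + ι v) - u x) ^ 2) := by gcongr
        _ = _ := by field_simp
    calc _ ≤ ∑ x, ((r : ℝ) ^ d)⁻¹ * ∑ v, (u (x + ι v) - u x) ^ 2 :=
          Finset.sum_le_sum fun x _ => h1 x
      _ = ((r : ℝ) ^ d)⁻¹ * ∑ v, ∑ x, (u (x + ι v) - u x) ^ 2 := by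
          rw [← Finset.mul_sum, Finset.sum_comm]
      _ ≤ ((r : ℝ) ^ d)⁻¹ * ∑ _v : Fin d → Fin r, d * r ^ 2 * energy u := by
          gcongr with v
          exact sum_sq_shift_le u r fun i => (v i).2.le
      _ = _ := by
          rw [Finset.sum_const, nsmul_eq_mul, hcard, ← mul_assoc, inv_mul_cancel₀ hrd.ne', one_mul]
  calc ∑ x, u x ^ 2 ≤ ∑ x, (2 * (u x - a x) ^ 2 + 2 * a x ^ 2) :=
        Finset.sum_le_sum fun x _ => by nlinarith [sq_nonneg (u x - 2 * a x)]
    _ = 2 * ∑ x, (u x - a x) ^ 2 + 2 * ∑ x, a x ^ 2 := by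
        rw [Finset.sum_add_distrib, Finset.mul_sum, Finset.mul_sum]
    _ ≤ _ := by linarith

end Torus

/-! ### Expected dissipation -/

section Expectation

/-- The integral equals
$p\left(\frac{2}{2+\mu}-\frac{2}{2+2\mu}\right)=\frac{2p\mu}{(2+\mu)(2+2\mu)}$, and the denominator
is at most $8$ for $\mu\le 1/2$. The subtraction is carried out by adding the second term to both
sides. -/
theorem lintegral_opening_expMeasure {p : unitInterval} {δ μ : ℝ} (hδ : 0 < δ) (hp : δ ≤ p)
    (hμ : 0 < μ) (hμ1 : μ ≤ 1 / 2) :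
    ENNReal.ofReal (δ * μ / 4) ≤
      ∫⁻ s, ENNReal.ofReal (p * (1 - Real.exp (-(μ * s))) * Real.exp (-(μ * s))) ∂expMeasure 2 := by
  have hp0 : (0 : ℝ) ≤ p := p.2.1
  have h0 : ∫⁻ s, ENNReal.ofReal (p * (1 - Real.exp (-(μ * s))) * Real.exp (-(μ * s))) ∂expMeasure 2
      + ENNReal.ofReal p * ∫⁻ s, ENNReal.ofReal (Real.exp (-(2 * μ * s))) ∂expMeasure 2 =
      ENNReal.ofReal p * ∫⁻ s, ENNReal.ofReal (Real.exp (-(μ * s))) ∂expMeasure 2 := by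
    rw [← lintegral_const_mul' _ _ ENNReal.ofReal_ne_top,
      ← lintegral_const_mul' _ _ ENNReal.ofReal_ne_top, ← lintegral_add_right _ (by fun_prop)]
    refine lintegral_congr_ae ?_
    filter_upwards [ae_expMeasure_pos 2] with s hs
    have h1 : 0 ≤ 1 - Real.exp (-(μ * s)) := by
      rw [sub_nonneg, Real.exp_le_one_iff]; nlinarith
    have h2 : Real.exp (-(2 * μ * s)) = Real.exp (-(μ * s)) * Real.exp (-(μ * s)) := by
      rw [← Real.exp_add]; ring_nf
    rw [← ENNReal.ofReal_mul hp0, ← ENNReal.ofReal_mul hp0, ← ENNReal.ofReal_add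
      (by positivity) (by positivity), h2]
    congr 1
    ring
  rw [lintegral_exp_neg_expMeasure two_pos (by positivity),
    lintegral_exp_neg_expMeasure two_pos hμ.le, ← ENNReal.ofReal_mul hp0,
    ← ENNReal.ofReal_mul hp0] at h0
  refine (ENNReal.add_le_add_iff_right (a := ENNReal.ofReal (p * (2 / (2 + 2 * μ))))
    ENNReal.ofReal_ne_top).1 ?_
  rw [h0, ← ENNReal.ofReal_add (by positivity) (by positivity)]
  refine ENNReal.ofReal_le_ofReal ?_
  have h3 : 2 / (2 + μ) - 2 / (2 + 2 * μ) = 2 * μ / ((2 + μ) * (2 + 2 * μ)) := by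
    field_simp; ring
  have h4 : μ / 4 ≤ 2 * μ / ((2 + μ) * (2 + 2 * μ)) := by
    rw [div_le_div_iff₀ (by norm_num) (by positivity)]
    nlinarith [mul_nonneg hμ.le hμ.le]
  have h5 : δ * (μ / 4) ≤ p * (2 / (2 + μ) - 2 / (2 + 2 * μ)) := by
    rw [h3]; gcongr
  linarith

theorem mem_edgeSet_add_single {n d : ℕ} (hn : 2 ≤ n) (y : Vertex n d) (i : Fin d) :
    s(y, y + Pi.single i 1) ∈ (torus n d).edgeSet := by
  have : Fact (1 < n) := ⟨hn⟩
  rw [SimpleGraph.mem_edgeSet, torus, SimpleGraph.fromRel_adj]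
  exact ⟨by simp, Or.inl ⟨i, rfl⟩⟩

theorem measurable_environment_elapsed {n d : ℕ} (η₀ : Config n d) (k : ℕ) :
    Measurable fun z : Clock Unit × (Edge n d → Clock Bool) =>
      environment η₀ z.2 (elapsed z.1 k).toNNReal := by
  have h1 : Measurable fun z : Clock Unit × (Edge n d → Clock Bool) =>
      (z.2, (elapsed z.1 k).toNNReal) :=
    measurable_snd.prodMk (measurable_real_toNNReal.comp
      ((measurable_elapsed k).comp measurable_fst))
  have h2 := (measurable_environment η₀).comp h1
  exact h2

variable {n d : ℕ} [NeZero n]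

theorem lazyWeight_zero (A : Set (Vertex n d)) (η : ℝ≥0 → Config n d) (x : Vertex n d)
    (ξ : Clock Unit) : lazyWeight A η x ξ 0 = open Classical in Pi.single x 1 := rfl

theorem lazyWeight_apply_mem {A : Set (Vertex n d)} (η : ℝ≥0 → Config n d) {x : Vertex n d}
    (hx : x ∉ A) (ξ : Clock Unit) (k : ℕ) {y : Vertex n d} (hy : y ∈ A) :
    lazyWeight A η x ξ k y = 0 := by
  induction k generalizing y with
  | zero =>
    rw [lazyWeight_zero, Pi.single_eq_of_ne]
    rintro rfl
    exact hx hy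
  | succ k ih =>
    rw [lazyWeight_succ]
    exact evolve_apply_mem _ (fun z hz => ih hz) hy

theorem sum_lazyWeight_le [NeZero d] (A : Set (Vertex n d)) (η : ℝ≥0 → Config n d) (x : Vertex n d)
    (ξ : Clock Unit) (k : ℕ) : ∑ y, lazyWeight A η x ξ k y ≤ 1 := by
  induction k with
  | zero => simp [lazyWeight_zero]
  | succ k ih =>
    rw [lazyWeight_succ]
    exact (sum_evolve_le _ _ _).trans ih

/-- Adaptedness: this supplies the hypothesis `hadapt` of `lintegral_open_environment`. -/
theorem lazyWeight_congr (A : Set (Vertex n d)) {η η' : ℝ≥0 → Config n d} (x : Vertex n d)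
    {ξ : Clock Unit} (hξ : ∀ i, 0 < (ξ i).1) {k : ℕ}
    (h : ∀ r ≤ (elapsed ξ k).toNNReal, η r = η' r) :
    lazyWeight A η x ξ k = lazyWeight A η' x ξ k := by
  induction k with
  | zero => rfl
  | succ k ih =>
    rw [lazyWeight_succ, lazyWeight_succ, h _ le_rfl, ih fun r hr => h r (hr.trans ?_)]
    exact Real.toNNReal_le_toNNReal ((elapsed_strictMono hξ).monotone (Nat.le_succ k))

theorem lazyWeight_update (A : Set (Vertex n d)) (η : ℝ≥0 → Config n d) (x : Vertex n d)
    (ξ : Clock Unit) (k : ℕ) (z : ℝ × Unit) :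
    lazyWeight A η x (Function.update ξ k z) k = lazyWeight A η x ξ k :=
  weight_update _ _ _ _ _

theorem measurable_lazyWeight (A : Set (Vertex n d)) (η₀ : Config n d) (x : Vertex n d) (k : ℕ)
    (y : Vertex n d) : Measurable fun z : Clock Unit × (Edge n d → Clock Bool) =>
      lazyWeight A (environment η₀ z.2) x z.1 k y := by
  classical
  induction k generalizing y with
  | zero => exact measurable_const
  | succ k ih =>
    simp only [lazyWeight_succ, evolve]
    refine Finset.measurable_fun_sum _ fun w _ => (ih w).mul ?_
    have h : Measurable fun ζ : Config n d =>
        2⁻¹ * ((if w = y then 1 else 0) + killedKernel A ζ w y) := measurable_of_finite _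
    have h2 := h.comp (measurable_environment_elapsed η₀ (k + 1))
    exact h2

/-- The expected squared norm of the weights of the lazy walk. -/
noncomputable def meanSq (p : unitInterval) (μ : ℝ) (A : Set (Vertex n d)) (η₀ : Config n d)
    (x : Vertex n d) (k : ℕ) : ℝ≥0∞ :=
  ∫⁻ z, ENNReal.ofReal (∑ y, (lazyWeight A (environment η₀ z.2) x z.1 k y : ℝ) ^ 2)
    ∂lazyNoise.prod (envNoise n d p μ)

/-- The expected Dirichlet energy of the weights of the lazy walk. -/
noncomputable def meanEnergy (p : unitInterval) (μ : ℝ) (A : Set (Vertex n d)) (η₀ : Config n d)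
    (x : Vertex n d) (k : ℕ) : ℝ≥0∞ :=
  ∫⁻ z, ENNReal.ofReal (energy fun y => (lazyWeight A (environment η₀ z.2) x z.1 k y : ℝ))
    ∂lazyNoise.prod (envNoise n d p μ)

variable {p : unitInterval} {δ μ : ℝ}

-- The gradient at ring $k$ is determined by the environment up to that ring, so the state of the
-- edge at the next ring can be bounded below conditionally, and then averaged over the waiting time
-- in between.
open Classical in
theorem lintegral_gradient_le [NeZero d] (hδ : 0 < δ) (hp : δ ≤ p) (hμ : 0 < μ) (hμ1 : μ ≤ 1 / 2)
    (hn : 2 ≤ n) (A : Set (Vertex n d)) (η₀ : Config n d) (x : Vertex n d) (k : ℕ)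
    (y : Vertex n d) (i : Fin d) :
    ENNReal.ofReal (δ * μ / 4) * ∫⁻ z,
        ENNReal.ofReal (((lazyWeight A (environment η₀ z.2) x z.1 k (y + Pi.single i 1) : ℝ) -
          lazyWeight A (environment η₀ z.2) x z.1 k y) ^ 2) ∂lazyNoise.prod (envNoise n d p μ) ≤
      ∫⁻ z, ENNReal.ofReal (if IsOpen (environment η₀ z.2 (elapsed z.1 (k + 1)).toNNReal) y
          (y + Pi.single i 1) then
        ((lazyWeight A (environment η₀ z.2) x z.1 k (y + Pi.single i 1) : ℝ) -
          lazyWeight A (environment η₀ z.2) x z.1 k y) ^ 2 else 0)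
        ∂lazyNoise.prod (envNoise n d p μ) := by
  have hprob := isProbabilityMeasure_envNoise n d p hμ
  have hexp := isProbabilityMeasure_expMeasure (r := 2) two_pos
  let e : Edge n d := ⟨_, mem_edgeSet_add_single hn y i⟩
  have hopen (ζ : Config n d) : IsOpen ζ y (y + Pi.single i 1) ↔ ζ e = true :=
    ⟨fun ⟨_, h⟩ => h, fun h => ⟨e.2, h⟩⟩
  let g : Clock Unit × (Edge n d → Clock Bool) → ℝ≥0∞ := fun z =>
    ENNReal.ofReal (((lazyWeight A (environment η₀ z.2) x z.1 k (y + Pi.single i 1) : ℝ) -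
          lazyWeight A (environment η₀ z.2) x z.1 k y) ^ 2)
  have hg : Measurable g :=
    (((measurable_lazyWeight A η₀ x k _).coe_nnreal_real.sub
      (measurable_lazyWeight A η₀ x k _).coe_nnreal_real).pow_const 2).ennreal_ofReal
  have hrw (z : Clock Unit × (Edge n d → Clock Bool)) :
      ENNReal.ofReal (if IsOpen (environment η₀ z.2 (elapsed z.1 (k + 1)).toNNReal) y
          (y + Pi.single i 1) then
        ((lazyWeight A (environment η₀ z.2) x z.1 k (y + Pi.single i 1) : ℝ) -
          lazyWeight A (environment η₀ z.2) x z.1 k y) ^ 2 else 0) =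
      if environment η₀ z.2 (elapsed z.1 (k + 1)).toNNReal e = true then g z else 0 := by
    simp only [hopen, g]
    split_ifs <;> simp
  simp_rw [hrw]
  have hms : MeasurableSet {z : Clock Unit × (Edge n d → Clock Bool) |
      environment η₀ z.2 (elapsed z.1 (k + 1)).toNNReal e = true} :=
    ((measurable_pi_apply e).comp (measurable_environment_elapsed η₀ (k + 1)))
      (measurableSet_singleton true)
  change _ * ∫⁻ z, g z ∂_ ≤ _
  rw [lintegral_prod _ hg.aemeasurable, lintegral_prod _ (hg.ite hms measurable_const).aemeasurable]
  let Γ : Clock Unit → ℝ≥0∞ := fun ξ => ∫⁻ ω, g (ξ, ω) ∂envNoise n d p μ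
  have hΓ : Measurable Γ := hg.lintegral_prod_right'
  let q : ℝ → ℝ≥0∞ := fun s =>
    ENNReal.ofReal (p * (1 - Real.exp (-(μ * s))) * Real.exp (-(μ * s)))
  have hq : Measurable q := by fun_prop
  calc ENNReal.ofReal (δ * μ / 4) * ∫⁻ ξ, Γ ξ ∂lazyNoise
      ≤ (∫⁻ s, q s ∂expMeasure 2) * ∫⁻ ξ, Γ ξ ∂lazyNoise := by
        gcongr
        exact lintegral_opening_expMeasure hδ hp hμ hμ1
    -- `Γ` involves only the first $k$ waiting times, hence is independent of waiting time number
    -- $k$.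
    _ = ∫⁻ ξ, q (ξ k).1 * Γ ξ ∂lazyNoise := by
        have hm : Measurable fun ξ : Clock Unit => q (ξ k).1 * Γ ξ :=
          (hq.comp (by fun_prop)).mul hΓ
        rw [lazyNoise, lintegral_clockLaw_update two_pos k hm, ← lintegral_const_mul _ hΓ]
        refine lintegral_congr fun ξ => ?_
        have h1 (z : ℝ × Unit) : Γ (Function.update ξ k z) = Γ ξ := by
          simp only [Γ, g, lazyWeight_update]
        simp only [h1, Function.update_self]
        have hq1 : Measurable fun z : ℝ × Unit => q z.1 := hq.comp measurable_fst
        rw [lintegral_mul_const _ hq1, lintegral_prod _ hq1.aemeasurable]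
        simp
    _ ≤ _ := by
        refine lintegral_mono_ae ?_
        filter_upwards [ae_clockLaw_pos (ν := Measure.dirac ()) two_pos] with ξ hξ
        have h0 := elapsed_nonneg hξ k
        have hsub : elapsed ξ (k + 1) - elapsed ξ k = (ξ k).1 := by
          rw [elapsed_succ, add_sub_cancel_left]
        have hle : (elapsed ξ k).toNNReal ≤ (elapsed ξ (k + 1)).toNNReal :=
          Real.toNNReal_le_toNNReal ((elapsed_strictMono hξ).monotone (Nat.le_succ k))
        have h := lintegral_open_environment (p := p) η₀ hμ hle e
          (g := fun ω => g (ξ, ω)) (hg.comp measurable_prodMk_left) fun ω ω' hω => by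
            simp only [g]
            rw [lazyWeight_congr A x hξ hω]
        rw [Real.coe_toNNReal _ h0, Real.coe_toNNReal _ (elapsed_nonneg hξ (k + 1)),
          hsub] at h
        exact h

/-- The average of `dissipation`: each edge is open with conditional probability at least
$\delta\mu/4$, so the open-edge energy is replaced by the full one, at the price of the constant
$\frac1{8d}\cdot\frac{\delta\mu}4$. -/
theorem meanSq_succ_add_le [NeZero d] (hδ : 0 < δ) (hp : δ ≤ p) (hμ : 0 < μ) (hμ1 : μ ≤ 1 / 2)
    (hn : 2 ≤ n) (A : Set (Vertex n d)) (η₀ : Config n d) (x : Vertex n d) (k : ℕ) :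
    meanSq p μ A η₀ x (k + 1) + ENNReal.ofReal (δ * μ / (32 * d)) * meanEnergy p μ A η₀ x k ≤
      meanSq p μ A η₀ x k := by
  classical
  have hprob := isProbabilityMeasure_envNoise n d p hμ
  let u : Clock Unit × (Edge n d → Clock Bool) → Vertex n d → ℝ := fun z y =>
    lazyWeight A (environment η₀ z.2) x z.1 k y
  have hu (y : Vertex n d) : Measurable fun z => u z y :=
    (measurable_lazyWeight A η₀ x k y).coe_nnreal_real
  let D : Clock Unit × (Edge n d → Clock Bool) → Vertex n d → Fin d → ℝ := fun z y i =>
    if IsOpen (environment η₀ z.2 (elapsed z.1 (k + 1)).toNNReal) y (y + Pi.single i 1) then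
      (u z (y + Pi.single i 1) - u z y) ^ 2 else 0
  have hD0 (z) (y : Vertex n d) (i : Fin d) : 0 ≤ D z y i := by
    simp only [D]; split_ifs <;> positivity
  have hgrad (y : Vertex n d) (i : Fin d) :
      Measurable fun z => ENNReal.ofReal ((u z (y + Pi.single i 1) - u z y) ^ 2) :=
    (((hu _).sub (hu _)).pow_const 2).ennreal_ofReal
  have hDm (y : Vertex n d) (i : Fin d) : Measurable fun z => ENNReal.ofReal (D z y i) := by
    have h1 : MeasurableSet {ζ : Config n d | IsOpen ζ y (y + Pi.single i 1)} :=
      Set.Finite.measurableSet (Set.toFinite _)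
    exact (Measurable.ite (measurable_environment_elapsed η₀ (k + 1) h1)
      (((hu _).sub (hu _)).pow_const 2) measurable_const).ennreal_ofReal
  have henergy : meanEnergy p μ A η₀ x k = ∑ y, ∑ i, ∫⁻ z,
      ENNReal.ofReal ((u z (y + Pi.single i 1) - u z y) ^ 2)
        ∂lazyNoise.prod (envNoise n d p μ) := by
    have : meanEnergy p μ A η₀ x k = ∫⁻ z, ∑ y, ∑ i,
        ENNReal.ofReal ((u z (y + Pi.single i 1) - u z y) ^ 2)
          ∂lazyNoise.prod (envNoise n d p μ) := by
      refine lintegral_congr fun z => ?_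
      rw [energy, Finset.sum_comm, ENNReal.ofReal_sum_of_nonneg fun _ _ =>
        Finset.sum_nonneg fun _ _ => sq_nonneg _]
      exact Finset.sum_congr rfl fun y _ => ENNReal.ofReal_sum_of_nonneg fun _ _ => sq_nonneg _
    rw [this, lintegral_finsetSum _ fun y _ => Finset.measurable_fun_sum _ fun i _ => hgrad y i]
    exact Finset.sum_congr rfl fun y _ => lintegral_finsetSum _ fun i _ => hgrad y i
  have hstep : ENNReal.ofReal (δ * μ / (32 * d)) * meanEnergy p μ A η₀ x k ≤
      ∫⁻ z, ENNReal.ofReal (8 * d : ℝ)⁻¹ * ∑ y, ∑ i, ENNReal.ofReal (D z y i)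
        ∂lazyNoise.prod (envNoise n d p μ) := by
    rw [lintegral_const_mul' _ _ ENNReal.ofReal_ne_top, lintegral_finsetSum _ fun y _ =>
      Finset.measurable_fun_sum _ fun i _ => hDm y i, henergy]
    have h1 : δ * μ / (32 * d) = (8 * d : ℝ)⁻¹ * (δ * μ / 4) := by
      field_simp; norm_num
    rw [h1, ENNReal.ofReal_mul (by positivity), mul_assoc, Finset.mul_sum]
    gcongr with y
    rw [lintegral_finsetSum _ fun i _ => hDm y i, Finset.mul_sum]
    gcongr with i
    exact lintegral_gradient_le hδ hp hμ hμ1 hn A η₀ x k y i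
  refine (add_le_add le_rfl hstep).trans ?_
  rw [meanSq, ← lintegral_add_left]
  · refine lintegral_mono fun z => ?_
    have h := dissipation (A := A) (environment η₀ z.2 (elapsed z.1 (k + 1)).toNNReal)
      (lazyWeight A (environment η₀ z.2) x z.1 k)
    have h2 := ENNReal.ofReal_le_ofReal h
    rw [ENNReal.ofReal_add (Finset.sum_nonneg fun _ _ => sq_nonneg _)
      (mul_nonneg (by positivity) (Finset.sum_nonneg fun y _ => Finset.sum_nonneg fun i _ =>
        hD0 z y i)), ENNReal.ofReal_mul (by positivity),
      ENNReal.ofReal_sum_of_nonneg (fun y _ => Finset.sum_nonneg fun i _ => hD0 z y i)] at h2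
    refine le_trans (le_of_eq ?_) h2
    congr 2
    refine Finset.sum_congr rfl fun y _ => ?_
    exact (ENNReal.ofReal_sum_of_nonneg fun i _ => hD0 z y i).symm
  · exact (Finset.measurable_fun_sum _ fun y _ =>
      (measurable_lazyWeight A η₀ x (k + 1) y).coe_nnreal_real.pow_const 2).ennreal_ofReal

theorem sum_sq_lazyWeight_le [NeZero d] (A : Set (Vertex n d)) (η : ℝ≥0 → Config n d)
    (x : Vertex n d) (ξ : Clock Unit) (k : ℕ) :
    ∑ y, (lazyWeight A η x ξ k y : ℝ) ^ 2 ≤ 1 := by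
  have h : ∑ y, (lazyWeight A η x ξ k y : ℝ) ≤ 1 := by
    exact_mod_cast sum_lazyWeight_le A η x ξ k
  refine (Finset.sum_le_sum fun y _ => ?_).trans h
  have h1 : (lazyWeight A η x ξ k y : ℝ) ≤ 1 :=
    (Finset.single_le_sum (f := fun y => (lazyWeight A η x ξ k y : ℝ))
      (fun _ _ => NNReal.coe_nonneg _) (Finset.mem_univ y)).trans h
  nlinarith [(lazyWeight A η x ξ k y).2]

theorem meanSq_le_one [NeZero d] (hμ : 0 < μ) (A : Set (Vertex n d)) (η₀ : Config n d)
    (x : Vertex n d) (k : ℕ) : meanSq p μ A η₀ x k ≤ 1 := by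
  have hprob := isProbabilityMeasure_envNoise n d p hμ
  calc meanSq p μ A η₀ x k ≤ ∫⁻ _, 1 ∂lazyNoise.prod (envNoise n d p μ) := by
        refine lintegral_mono fun z => ?_
        rw [← ENNReal.ofReal_one]
        exact ENNReal.ofReal_le_ofReal (sum_sq_lazyWeight_le A _ x _ k)
    _ = 1 := by simp

theorem meanSq_le_meanEnergy {A : Finset (Vertex n d)} (hA : (n : ℝ) ^ d / 2 ≤ A.card)
    (η₀ : Config n d) {x : Vertex n d} (hx : x ∉ A) (k : ℕ) :
    meanSq p μ A η₀ x k ≤ ENNReal.ofReal (d * n ^ 2) * meanEnergy p μ A η₀ x k := by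
  rw [meanEnergy, ← lintegral_const_mul' _ _ ENNReal.ofReal_ne_top]
  refine lintegral_mono fun z => ?_
  rw [← ENNReal.ofReal_mul (by positivity)]
  refine ENNReal.ofReal_le_ofReal (sum_sq_le_energy hA fun y hy => ?_)
  rw [lazyWeight_apply_mem _ (by simpa using hx) _ _ (by simpa using hy)]
  rfl

theorem meanSq_le_meanEnergy_add [NeZero d] (hμ : 0 < μ) (A : Set (Vertex n d)) (η₀ : Config n d)
    (x : Vertex n d) (k : ℕ) {r : ℕ} (hr : 0 < r) (hrn : r ≤ n) :
    meanSq p μ A η₀ x k ≤ ENNReal.ofReal (2 * d * r ^ 2) * meanEnergy p μ A η₀ x k +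
      ENNReal.ofReal (2 * ((r : ℝ) ^ d)⁻¹) := by
  have hprob := isProbabilityMeasure_envNoise n d p hμ
  have hc : ENNReal.ofReal (2 * ((r : ℝ) ^ d)⁻¹) =
      ∫⁻ _, ENNReal.ofReal (2 * ((r : ℝ) ^ d)⁻¹) ∂lazyNoise.prod (envNoise n d p μ) := by simp
  rw [hc, meanEnergy, ← lintegral_const_mul' _ _ ENNReal.ofReal_ne_top,
    ← lintegral_add_right _ measurable_const]
  refine lintegral_mono fun z => ?_
  rw [← ENNReal.ofReal_mul (by positivity), ← ENNReal.ofReal_add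
    (mul_nonneg (by positivity) (energy_nonneg _)) (by positivity)]
  refine ENNReal.ofReal_le_ofReal ?_
  have h := sum_sq_le_energy_add (u := fun y => (lazyWeight A (environment η₀ z.2) x z.1 k y : ℝ))
    (fun _ => NNReal.coe_nonneg _) (by exact_mod_cast sum_lazyWeight_le A _ x _ k) hr hrn
  linarith

end Expectation

/-! ### Decay of the mean square and of the mass -/

section Decay

theorem le_geometric {α : ℕ → ℝ} {θ : ℝ} (hθ : θ ≤ 1) (h : ∀ k, α (k + 1) ≤ (1 - θ) * α k)
    (j k : ℕ) : α (j + k) ≤ (1 - θ) ^ k * α j := by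
  induction k with
  | zero => simp
  | succ k ih =>
    calc α (j + k + 1) ≤ (1 - θ) * α (j + k) := h _
      _ ≤ (1 - θ) * ((1 - θ) ^ k * α j) := mul_le_mul_of_nonneg_left ih (by linarith)
      _ = _ := by ring

theorem one_sub_pow_le_exp {x : ℝ} (hx1 : x ≤ 1) (m : ℕ) : (1 - x) ^ m ≤ Real.exp (-(x * m)) := by
  calc (1 - x) ^ m ≤ Real.exp (-x) ^ m :=
        pow_le_pow_left₀ (by linarith) (by linarith [Real.add_one_le_exp (-x)]) m
    _ = _ := by rw [← Real.exp_nat_mul]; ring_nf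

/-- Contraction at every scale up to `n` brings a sequence to its value at scale `n` within order
`n ^ 2` steps. -/
theorem exists_le_of_multiscale {α : ℕ → ℝ} {γ : ℝ} (hγ : 0 < γ) (hγ1 : γ ≤ 1) (h0 : α 0 ≤ 1)
    {n d : ℕ} (hn : 0 < n)
    (h : ∀ k r : ℕ, 0 < r → r ≤ n →
      α (k + 1) - 2 * ((r : ℝ) ^ d)⁻¹ ≤ (1 - γ / r ^ 2) * (α k - 2 * ((r : ℝ) ^ d)⁻¹)) :
    ∃ k : ℕ, (k : ℝ) ≤ 2 * ((d + 1) * Real.log 2 + 1) * n ^ 2 / γ ∧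
      α k ≤ 4 * ((n : ℝ) ^ d)⁻¹ := by
  set Λ : ℝ := (d + 1) * Real.log 2 with hΛ
  have hΛ0 : 0 ≤ Λ := by positivity
  have key (r : ℕ) (hr : 0 < r) (hrn : r ≤ n) :
      ∃ k : ℕ, (k : ℝ) ≤ 2 * (Λ + 1) * r ^ 2 / γ ∧ α k ≤ 4 * ((r : ℝ) ^ d)⁻¹ := by
    induction r using Nat.strong_induction_on with
    | _ r ih =>
      rcases Nat.lt_or_ge r 2 with hr2 | hr2
      · obtain rfl : r = 1 := by omega
        exact ⟨0, by simp; positivity, by simpa using h0.trans (by norm_num)⟩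
      -- Induct from scale $r'=\lceil r/2\rceil$. Rounding up gives $r\le 2r'$, so the bound at
      -- scale $r'$ costs at most a factor $2^d$ at scale $r$; also $r'\le 2r/3$, so $r'^2\le r^2/2$
      -- and the step counts add up like a geometric series.
      obtain ⟨k, hk, hαk⟩ := ih ((r + 1) / 2) (by omega) (by omega) (by omega)
      set r' := (r + 1) / 2 with hr'
      have hlow : (r : ℝ) ≤ 2 * r' := by
        have : r ≤ 2 * r' := by omega
        exact_mod_cast this
      have hup : 3 * (r' : ℝ) ≤ 2 * r := by
        have : 3 * r' ≤ 2 * r := by omega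
        exact_mod_cast this
      have hr0 : (0 : ℝ) < r := by exact_mod_cast hr
      have hr1 : (1 : ℝ) ≤ r := by exact_mod_cast hr
      have hr'0 : (0 : ℝ) < r' := by linarith
      -- Enough steps to shrink the excess over $2r^{-d}$ by $e^{-\Lambda}=2^{-(d+1)}$: it starts
      -- below $4\cdot 2^d r^{-d}$ and ends below $2r^{-d}$.
      set m := ⌈r ^ 2 * Λ / γ⌉₊ with hm
      have hm1 : (m : ℝ) ≤ r ^ 2 * Λ / γ + 1 := (Nat.ceil_lt_add_one (by positivity)).le
      have hm2 : r ^ 2 * Λ / γ ≤ m := Nat.le_ceil _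
      have hrsq : 1 ≤ (r : ℝ) ^ 2 / γ := by
        rw [le_div_iff₀ hγ]; nlinarith
      have hx1 : γ / (r : ℝ) ^ 2 ≤ 1 := by
        rw [div_le_one (by positivity)]; nlinarith
      refine ⟨k + m, ?_, ?_⟩
      · push_cast
        have hr'sq : (r' : ℝ) ^ 2 ≤ r ^ 2 / 2 := by nlinarith
        have h1 : 2 * (Λ + 1) * (r' : ℝ) ^ 2 / γ ≤ 2 * (Λ + 1) * (r ^ 2 / 2) / γ := by gcongr
        have h2 : 2 * (Λ + 1) * (r : ℝ) ^ 2 / γ =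
          2 * (Λ + 1) * (r ^ 2 / 2) / γ + (r ^ 2 * Λ / γ + r ^ 2 / γ) := by ring
        linarith
      · have hgeom := le_geometric (α := fun k => α k - 2 * ((r : ℝ) ^ d)⁻¹) hx1
          (fun k => h k r hr hrn) k m
        have hexp : (1 - γ / (r : ℝ) ^ 2) ^ m ≤ (2 ^ (d + 1))⁻¹ := by
          refine (one_sub_pow_le_exp hx1 m).trans ?_
          have : Λ ≤ γ / (r : ℝ) ^ 2 * m := by
            calc Λ = γ / (r : ℝ) ^ 2 * (r ^ 2 * Λ / γ) := by field_simp
              _ ≤ _ := by gcongr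
          calc Real.exp (-(γ / (r : ℝ) ^ 2 * m)) ≤ Real.exp (-Λ) :=
                Real.exp_le_exp.2 (by linarith)
            _ = _ := by
                rw [Real.exp_neg, hΛ]
                congr 1
                have := Real.exp_nat_mul (Real.log 2) (d + 1)
                rw [Real.exp_log two_pos] at this
                rw [← this]
                push_cast
                rfl
        have hpow0 : 0 ≤ (1 - γ / (r : ℝ) ^ 2) ^ m := pow_nonneg (by linarith) m
        have hscale : ((r' : ℝ) ^ d)⁻¹ ≤ 2 ^ d * ((r : ℝ) ^ d)⁻¹ := by
          rw [← inv_inv ((2 : ℝ) ^ d), ← mul_inv]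
          gcongr
          rw [← inv_pow, ← mul_pow]
          gcongr
          linarith
        have hrd : 0 < ((r : ℝ) ^ d)⁻¹ := by positivity
        have h3 : (1 - γ / (r : ℝ) ^ 2) ^ m * (α k - 2 * ((r : ℝ) ^ d)⁻¹) ≤
            (2 ^ (d + 1))⁻¹ * (4 * (2 ^ d * ((r : ℝ) ^ d)⁻¹)) := by
          calc _ ≤ (1 - γ / (r : ℝ) ^ 2) ^ m * (4 * (2 ^ d * ((r : ℝ) ^ d)⁻¹)) := by
                refine mul_le_mul_of_nonneg_left ?_ hpow0
                linarith
            _ ≤ _ := by gcongr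
        have h4 : ((2 : ℝ) ^ (d + 1))⁻¹ * (4 * (2 ^ d * ((r : ℝ) ^ d)⁻¹)) =
            2 * ((r : ℝ) ^ d)⁻¹ := by
          rw [pow_succ]; field_simp; norm_num
        linarith
  exact key n hn le_rfl

variable {n d : ℕ} [NeZero n] {p : unitInterval} {δ μ : ℝ}

/-- The probability that the lazy walk in the environment `η` survives `k` rings. -/
noncomputable def mass (A : Set (Vertex n d)) (η : ℝ≥0 → Config n d) (x : Vertex n d) (k : ℕ) :
    ℝ≥0∞ :=
  ∫⁻ ξ, ∑ y, (lazyWeight A η x ξ k y : ℝ≥0∞) ∂lazyNoise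

theorem measurable_mass (A : Set (Vertex n d)) (η₀ : Config n d) (x : Vertex n d) (k : ℕ) :
    Measurable fun ω => mass A (environment η₀ ω) x k :=
  Measurable.lintegral_prod_left' (f := fun z : Clock Unit × (Edge n d → Clock Bool) =>
    ∑ y, (lazyWeight A (environment η₀ z.2) x z.1 k y : ℝ≥0∞))
    (Finset.measurable_fun_sum _ fun y _ =>
      (measurable_lazyWeight A η₀ x k y).coe_nnreal_ennreal)

variable [NeZero d]

theorem meanSq_toReal_le_one (hμ : 0 < μ) (A : Set (Vertex n d)) (η₀ : Config n d)
    (x : Vertex n d) (k : ℕ) : (meanSq p μ A η₀ x k).toReal ≤ 1 :=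
  ENNReal.toReal_le_of_le_ofReal zero_le_one (by simpa using meanSq_le_one hμ A η₀ x k)

/-- Dissipation itself bounds the mean energy, since the mean square never exceeds $1$. Finiteness
permits real arithmetic from here on. -/
theorem meanEnergy_ne_top (hδ : 0 < δ) (hp : δ ≤ p) (hμ : 0 < μ) (hμ1 : μ ≤ 1 / 2)
    (hn : 2 ≤ n) (A : Set (Vertex n d)) (η₀ : Config n d) (x : Vertex n d) (k : ℕ) :
    meanEnergy p μ A η₀ x k ≠ ∞ := by
  intro htop
  have hd : (0 : ℝ) < d := by exact_mod_cast NeZero.pos d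
  have h := (meanSq_succ_add_le hδ hp hμ hμ1 hn A η₀ x k).trans (meanSq_le_one hμ A η₀ x k)
  rw [htop, ENNReal.mul_top (by simpa using by positivity), add_top] at h
  simp at h

theorem meanSq_toReal_succ_add_le (hδ : 0 < δ) (hp : δ ≤ p) (hμ : 0 < μ) (hμ1 : μ ≤ 1 / 2)
    (hn : 2 ≤ n) (A : Set (Vertex n d)) (η₀ : Config n d) (x : Vertex n d) (k : ℕ) :
    (meanSq p μ A η₀ x (k + 1)).toReal +
      δ * μ / (32 * d) * (meanEnergy p μ A η₀ x k).toReal ≤ (meanSq p μ A η₀ x k).toReal := by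
  have hfin (k : ℕ) : meanSq p μ A η₀ x k ≠ ∞ :=
    ne_top_of_le_ne_top ENNReal.one_ne_top (meanSq_le_one hμ A η₀ x k)
  have hE := meanEnergy_ne_top hδ hp hμ hμ1 hn A η₀ x k
  have h := ENNReal.toReal_mono (hfin k) (meanSq_succ_add_le hδ hp hμ hμ1 hn A η₀ x k)
  rwa [ENNReal.toReal_add (hfin _) (ENNReal.mul_ne_top ENNReal.ofReal_ne_top hE),
    ENNReal.toReal_mul, ENNReal.toReal_ofReal (by positivity)] at h

theorem meanSq_toReal_succ_le (hδ : 0 < δ) (hp : δ ≤ p) (hμ : 0 < μ) (hμ1 : μ ≤ 1 / 2)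
    (hn : 2 ≤ n) {A : Finset (Vertex n d)} (hA : (n : ℝ) ^ d / 2 ≤ A.card) (η₀ : Config n d)
    {x : Vertex n d} (hx : x ∉ A) (k : ℕ) :
    (meanSq p μ A η₀ x (k + 1)).toReal ≤
      (1 - δ * μ / (32 * d ^ 2 * n ^ 2)) * (meanSq p μ A η₀ x k).toReal := by
  have hd : (0 : ℝ) < d := by exact_mod_cast NeZero.pos d
  have hn0 : (0 : ℝ) < n := by exact_mod_cast NeZero.pos n
  have h1 := meanSq_toReal_succ_add_le hδ hp hμ hμ1 hn A η₀ x k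
  have hE := meanEnergy_ne_top hδ hp hμ hμ1 hn A η₀ x k
  have h2 := ENNReal.toReal_mono (ENNReal.mul_ne_top ENNReal.ofReal_ne_top hE)
    (meanSq_le_meanEnergy (p := p) (μ := μ) hA η₀ hx k)
  rw [ENNReal.toReal_mul, ENNReal.toReal_ofReal (by positivity)] at h2
  have h3 : δ * μ / (32 * d ^ 2 * n ^ 2) * (meanSq p μ A η₀ x k).toReal ≤
      δ * μ / (32 * d) * (meanEnergy p μ A η₀ x k).toReal := by
    calc _ ≤ δ * μ / (32 * d ^ 2 * n ^ 2) * (d * n ^ 2 * (meanEnergy p μ A η₀ x k).toReal) := by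
          gcongr
      _ = _ := by field_simp
  linarith

theorem meanSq_toReal_multiscale (hδ : 0 < δ) (hp : δ ≤ p) (hμ : 0 < μ) (hμ1 : μ ≤ 1 / 2)
    (hn : 2 ≤ n) (A : Set (Vertex n d)) (η₀ : Config n d) (x : Vertex n d) (k r : ℕ) (hr : 0 < r)
    (hrn : r ≤ n) :
    (meanSq p μ A η₀ x (k + 1)).toReal - 2 * ((r : ℝ) ^ d)⁻¹ ≤
      (1 - δ * μ / (64 * d ^ 2) / r ^ 2) *
        ((meanSq p μ A η₀ x k).toReal - 2 * ((r : ℝ) ^ d)⁻¹) := by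
  have hd : (0 : ℝ) < d := by exact_mod_cast NeZero.pos d
  have hr0 : (0 : ℝ) < r := by exact_mod_cast hr
  have h1 := meanSq_toReal_succ_add_le hδ hp hμ hμ1 hn A η₀ x k
  have hE := meanEnergy_ne_top hδ hp hμ hμ1 hn A η₀ x k
  have hfin : ENNReal.ofReal (2 * d * r ^ 2) * meanEnergy p μ A η₀ x k ≠ ∞ :=
    ENNReal.mul_ne_top ENNReal.ofReal_ne_top hE
  have h2 := ENNReal.toReal_mono (ENNReal.add_ne_top.2 ⟨hfin, ENNReal.ofReal_ne_top⟩)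
    (meanSq_le_meanEnergy_add (p := p) hμ A η₀ x k hr hrn)
  rw [ENNReal.toReal_add hfin ENNReal.ofReal_ne_top, ENNReal.toReal_mul,
    ENNReal.toReal_ofReal (by positivity), ENNReal.toReal_ofReal (by positivity)] at h2
  have h3 : δ * μ / (64 * d ^ 2) / r ^ 2 *
      ((meanSq p μ A η₀ x k).toReal - 2 * ((r : ℝ) ^ d)⁻¹) ≤
      δ * μ / (32 * d) * (meanEnergy p μ A η₀ x k).toReal := by
    calc _ ≤ δ * μ / (64 * d ^ 2) / r ^ 2 *
          (2 * d * r ^ 2 * (meanEnergy p μ A η₀ x k).toReal) := by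
          gcongr; linarith
      _ = _ := by field_simp; ring
  linarith

theorem mass_le_one (A : Set (Vertex n d)) (η : ℝ≥0 → Config n d) (x : Vertex n d) (k : ℕ) :
    mass A η x k ≤ 1 := by
  calc mass A η x k ≤ ∫⁻ _, 1 ∂lazyNoise := lintegral_mono fun ξ => by
        have h : ((∑ y, lazyWeight A η x ξ k y : ℝ≥0) : ℝ≥0∞) ≤ 1 := by
          exact_mod_cast sum_lazyWeight_le A η x ξ k
        push_cast at h
        exact h
    _ = 1 := by simp

/-- Cauchy–Schwarz on the torus, $S^2\le n^d\|u\|_2^2$, combined pointwise with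
$S\le\frac12(\beta+S^2/\beta)$. The free parameter $\beta$ replaces a square root and keeps the
bound linear under the expectation. -/
theorem lintegral_mass_le (hμ : 0 < μ) (A : Set (Vertex n d)) (η₀ : Config n d) (x : Vertex n d)
    (k : ℕ) {β : ℝ} (hβ : 0 < β) :
    ∫⁻ ω, mass A (environment η₀ ω) x k ∂envNoise n d p μ ≤
      ENNReal.ofReal ((β + n ^ d * (meanSq p μ A η₀ x k).toReal / β) / 2) := by
  have hprob := isProbabilityMeasure_envNoise n d p hμ
  have hm : Measurable fun z : Clock Unit × (Edge n d → Clock Bool) =>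
      ∑ y, (lazyWeight A (environment η₀ z.2) x z.1 k y : ℝ≥0∞) :=
    Finset.measurable_fun_sum _ fun y _ =>
      (measurable_lazyWeight A η₀ x k y).coe_nnreal_ennreal
  have hcard : ((Finset.univ : Finset (Vertex n d)).card : ℝ) = n ^ d := by simp [ZMod.card]
  have hfin : meanSq p μ A η₀ x k ≠ ∞ :=
    ne_top_of_le_ne_top ENNReal.one_ne_top (meanSq_le_one hμ A η₀ x k)
  have h1 : (β + n ^ d * (meanSq p μ A η₀ x k).toReal / β) / 2 =
      β / 2 + n ^ d / (2 * β) * (meanSq p μ A η₀ x k).toReal := by field_simp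
  rw [h1, ENNReal.ofReal_add (by positivity) (by positivity), ENNReal.ofReal_mul (by positivity),
    ENNReal.ofReal_toReal hfin]
  simp only [mass]
  rw [← lintegral_prod_symm _ hm.aemeasurable, meanSq,
    ← lintegral_const_mul' _ _ ENNReal.ofReal_ne_top]
  have hc : ENNReal.ofReal (β / 2) =
      ∫⁻ _, ENNReal.ofReal (β / 2) ∂lazyNoise.prod (envNoise n d p μ) := by simp
  rw [hc, ← lintegral_add_left measurable_const]
  refine lintegral_mono fun z => ?_
  rw [← ENNReal.ofReal_mul (by positivity), ← ENNReal.ofReal_add (by positivity) (by positivity)]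
  set u := lazyWeight A (environment η₀ z.2) x z.1 k with hu
  have h2 : (∑ y, (u y : ℝ≥0∞)) = ENNReal.ofReal (∑ y, (u y : ℝ)) := by
    rw [ENNReal.ofReal_sum_of_nonneg fun _ _ => NNReal.coe_nonneg _]
    simp
  rw [h2]
  refine ENNReal.ofReal_le_ofReal ?_
  have h3 := sq_sum_le_card_mul_sum_sq (s := Finset.univ) (f := fun y => (u y : ℝ))
  rw [hcard] at h3
  set S := ∑ y, (u y : ℝ) with hS
  have h4 : S ≤ β / 2 + S ^ 2 / (2 * β) := by
    have : β / 2 + S ^ 2 / (2 * β) - S = (S - β) ^ 2 / (2 * β) := by field_simp; ring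
    have h5 : 0 ≤ (S - β) ^ 2 / (2 * β) := by positivity
    linarith
  calc S ≤ β / 2 + S ^ 2 / (2 * β) := h4
    _ ≤ β / 2 + (n ^ d * ∑ y, (u y : ℝ) ^ 2) / (2 * β) := by gcongr
    _ = _ := by ring

end Decay

/-! ### Hitting times -/

section Hitting

theorem tsum_ofReal_geometric {ρ : ℝ} (h0 : 0 ≤ ρ) (h1 : ρ < 1) :
    ∑' j : ℕ, ENNReal.ofReal (ρ ^ j) = ENNReal.ofReal (1 - ρ)⁻¹ := by
  rw [← ENNReal.ofReal_tsum_of_nonneg (fun j => pow_nonneg h0 j)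
    (summable_geometric_of_lt_one h0 h1), tsum_geometric_of_lt_one h0 h1]

theorem tsum_eq_sum_add_tsum (f : ℕ → ℝ≥0∞) (N : ℕ) :
    ∑' k, f k = ∑ k ∈ Finset.range N, f k + ∑' k, f (k + N) :=
  (Summable.sum_add_tsum_nat_add' ENNReal.summable).symm

variable {n d : ℕ} {p : unitInterval} {δ μ : ℝ}

theorem measurable_environment_path (η₀ : Config n d) (ω : Edge n d → Clock Bool) :
    Measurable (environment η₀ ω) := by
  have h := (measurable_environment η₀).comp (measurable_prodMk_left (x := ω))
  exact h

/-- This half of Tonelli's theorem needs no measurability, so joint measurability of the hitting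
time is never required. -/
theorem annealedHitting_le_lintegral [NeZero d] (hμ : 0 < μ) (A : Set (Vertex n d))
    (η₀ : Config n d)
    (x : Vertex n d) : annealedHitting p μ A x η₀ ≤
      ∫⁻ ω, quenchedHitting A x (environment η₀ ω) ∂envNoise n d p μ := by
  have := isProbabilityMeasure_envNoise n d p hμ
  have := isProbabilityMeasure_walkNoise d
  exact lintegral_prod_le _

variable [NeZero n] [NeZero d]

/-- The rate of the exponential decay of the mean square. -/
noncomputable def decayRate (δ μ : ℝ) (d n : ℕ) : ℝ := δ * μ / (32 * d ^ 2 * n ^ 2)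

theorem decayRate_pos (hδ : 0 < δ) (hμ : 0 < μ) : 0 < decayRate δ μ d n := by
  have hd : (0 : ℝ) < d := by exact_mod_cast NeZero.pos d
  have hn0 : (0 : ℝ) < n := by exact_mod_cast NeZero.pos n
  unfold decayRate
  positivity

theorem decayRate_le_one (hδ : 0 < δ) (hp : δ ≤ p) (hμ : 0 < μ) (hμ1 : μ ≤ 1 / 2) :
    decayRate δ μ d n ≤ 1 := by
  have hd : (1 : ℝ) ≤ d := by exact_mod_cast NeZero.one_le
  have hn0 : (1 : ℝ) ≤ n := by exact_mod_cast NeZero.one_le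
  have hp1 : (p : ℝ) ≤ 1 := p.2.2
  have h1 : (1 : ℝ) ≤ (d : ℝ) ^ 2 := one_le_pow₀ hd
  have h2 : (1 : ℝ) ≤ (n : ℝ) ^ 2 := one_le_pow₀ hn0
  have h3 : (1 : ℝ) ≤ (d : ℝ) ^ 2 * (n : ℝ) ^ 2 := one_le_mul_of_one_le_of_one_le h1 h2
  unfold decayRate
  rw [div_le_one (by positivity)]
  nlinarith

theorem one_sub_pow_le_sq {θ : ℝ} (hθ1 : θ ≤ 1) (j : ℕ) :
    (1 - θ) ^ j ≤ ((1 - θ / 2) ^ j) ^ 2 := by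
  rw [← pow_mul, mul_comm, pow_mul]
  exact pow_le_pow_left₀ (by linarith) (by nlinarith [sq_nonneg θ]) j

/-- Take $\beta=\rho^j$ with $\rho=1-\theta/2$ in `lintegral_mass_le`: the mean square has decayed
by $(1-\theta)^j\le\rho^{2j}$, so both terms are of order $\rho^j$. -/
theorem lintegral_mass_add_le (hδ : 0 < δ) (hp : δ ≤ p) (hμ : 0 < μ) (hμ1 : μ ≤ 1 / 2)
    (hn : 2 ≤ n) {A : Finset (Vertex n d)} (hA : (n : ℝ) ^ d / 2 ≤ A.card) (η₀ : Config n d)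
    {x : Vertex n d} (hx : x ∉ A) {k : ℕ} {b : ℝ}
    (hk : (meanSq p μ A η₀ x k).toReal ≤ b) (j : ℕ) :
    ∫⁻ ω, mass A (environment η₀ ω) x (k + j) ∂envNoise n d p μ ≤
      ENNReal.ofReal ((1 + n ^ d * b) / 2 * (1 - decayRate δ μ d n / 2) ^ j) := by
  have hθ := decayRate_pos (d := d) (n := n) hδ hμ
  have hθ1 := decayRate_le_one (d := d) (n := n) hδ hp hμ hμ1
  set θ := decayRate δ μ d n with hθdef
  set ρ := 1 - θ / 2 with hρ
  have hρ0 : 0 < ρ := by linarith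
  have hb : 0 ≤ b := ENNReal.toReal_nonneg.trans hk
  refine (lintegral_mass_le hμ _ η₀ x (k + j) (pow_pos hρ0 j)).trans
    (ENNReal.ofReal_le_ofReal ?_)
  have h1 := le_geometric (α := fun k => (meanSq p μ (A : Set (Vertex n d)) η₀ x k).toReal) hθ1
    (fun k => meanSq_toReal_succ_le hδ hp hμ hμ1 hn hA η₀ hx k) k j
  have h2 : (meanSq p μ A η₀ x (k + j)).toReal ≤ (ρ ^ j) ^ 2 * b :=
    h1.trans (mul_le_mul (one_sub_pow_le_sq hθ1 j) hk ENNReal.toReal_nonneg (by positivity))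
  have h3 : (n : ℝ) ^ d * (meanSq p μ A η₀ x (k + j)).toReal / ρ ^ j ≤ n ^ d * b * ρ ^ j := by
    rw [div_le_iff₀ (by positivity)]
    calc (n : ℝ) ^ d * (meanSq p μ A η₀ x (k + j)).toReal ≤ n ^ d * ((ρ ^ j) ^ 2 * b) := by gcongr
      _ = _ := by ring
  linarith

theorem annealedHitting_le (hδ : 0 < δ) (hp : δ ≤ p) (hμ : 0 < μ) (hμ1 : μ ≤ 1 / 2)
    (hn : 2 ≤ n) {A : Finset (Vertex n d)} (hA : (n : ℝ) ^ d / 2 ≤ A.card) (η₀ : Config n d)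
    (x : Vertex n d) :
    annealedHitting p μ A x η₀ ≤ ENNReal.ofReal
      (64 * d ^ 2 / δ * ((d + 1) * Real.log 2 + 3) * n ^ 2 / μ) := by
  have hd : (1 : ℝ) ≤ d := by exact_mod_cast NeZero.one_le
  have hn0 : (1 : ℝ) ≤ n := by exact_mod_cast NeZero.one_le
  have hp1 : (p : ℝ) ≤ 1 := p.2.2
  have hprob := isProbabilityMeasure_envNoise n d p hμ
  refine (annealedHitting_le_lintegral hμ _ η₀ x).trans ?_
  by_cases hx : x ∈ A
  · simp [quenchedHitting_eq_zero (A : Set (Vertex n d)) _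
      (show x ∈ (A : Set (Vertex n d)) from hx)]
  have hx' : x ∉ (A : Set (Vertex n d)) := by simpa using hx
  have hγ1 : δ * μ / (64 * d ^ 2) ≤ 1 := by
    have h1 : (1 : ℝ) ≤ (d : ℝ) ^ 2 := one_le_pow₀ hd
    rw [div_le_one (by positivity)]
    nlinarith
  obtain ⟨k, hk, hαk⟩ := exists_le_of_multiscale
    (α := fun k => (meanSq p μ (A : Set (Vertex n d)) η₀ x k).toReal) (d := d) (by positivity) hγ1
    (meanSq_toReal_le_one (p := p) hμ (A : Set (Vertex n d)) η₀ x 0) (NeZero.pos n)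
    (fun k r hr hrn => meanSq_toReal_multiscale hδ hp hμ hμ1 hn _ η₀ x k r hr hrn)
  have hθ := decayRate_pos (d := d) (n := n) hδ hμ
  have hθ1 := decayRate_le_one (d := d) (n := n) hδ hp hμ hμ1
  set θ := decayRate δ μ d n with hθdef
  let b : ℕ → ℝ≥0∞ := fun k => ∫⁻ ω, mass A (environment η₀ ω) x k ∂envNoise n d p μ
  have hb1 (k : ℕ) : b k ≤ 1 := by
    calc b k ≤ ∫⁻ _, 1 ∂envNoise n d p μ := lintegral_mono fun ω => mass_le_one _ _ _ _
      _ = 1 := by simp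
  -- At ring $k$ the mean square is at most $4n^{-d}$, so the volume cancels and the prefactor is
  -- $(1+4)/2$.
  have hbk (j : ℕ) : b (j + k) ≤ ENNReal.ofReal (5 / 2) * ENNReal.ofReal ((1 - θ / 2) ^ j) := by
    have h := lintegral_mass_add_le hδ hp hμ hμ1 hn hA η₀ hx hαk j
    rw [add_comm j k, ← ENNReal.ofReal_mul (by norm_num)]
    refine h.trans (ENNReal.ofReal_le_ofReal (le_of_eq ?_))
    have : (n : ℝ) ^ d * (4 * ((n : ℝ) ^ d)⁻¹) = 4 := by field_simp
    rw [this]; norm_num [hθdef]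
  have hsum : ∑' k, b k ≤ ENNReal.ofReal (k + 5 / 2 * (θ / 2)⁻¹) := by
    rw [tsum_eq_sum_add_tsum b k, ENNReal.ofReal_add (by positivity) (by positivity)]
    refine add_le_add ?_ ?_
    · calc ∑ j ∈ Finset.range k, b j ≤ ∑ _j ∈ Finset.range k, 1 :=
            Finset.sum_le_sum fun j _ => hb1 j
        _ = _ := by simp
    · refine (ENNReal.tsum_le_tsum hbk).trans (le_of_eq ?_)
      rw [ENNReal.tsum_mul_left, tsum_ofReal_geometric (by linarith) (by linarith),
        ← ENNReal.ofReal_mul (by norm_num)]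
      congr 3
      ring
  calc ∫⁻ ω, quenchedHitting A x (environment η₀ ω) ∂envNoise n d p μ
      ≤ ∫⁻ ω, 2⁻¹ * ∑' k, mass A (environment η₀ ω) x k ∂envNoise n d p μ :=
        lintegral_mono fun ω => quenchedHitting_le _ (measurable_environment_path η₀ ω) hx'
    _ = 2⁻¹ * ∑' k, b k := by
        rw [lintegral_const_mul' _ _ (by simp), lintegral_tsum fun k =>
          (measurable_mass _ η₀ x k).aemeasurable]
    _ ≤ ENNReal.ofReal 2⁻¹ * ENNReal.ofReal (k + 5 / 2 * (θ / 2)⁻¹) := by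
        rw [ENNReal.ofReal_inv_of_pos two_pos, ENNReal.ofReal_ofNat]
        gcongr
    _ ≤ _ := by
        rw [← ENNReal.ofReal_mul (by norm_num)]
        refine ENNReal.ofReal_le_ofReal ?_
        have h1 : (θ / 2)⁻¹ = 64 * d ^ 2 / δ * n ^ 2 / μ := by
          rw [hθdef, decayRate]; field_simp; norm_num
        have h2 : 2 * ((d + 1) * Real.log 2 + 1) * n ^ 2 / (δ * μ / (64 * d ^ 2)) =
            2 * ((d + 1) * Real.log 2 + 1) * (64 * d ^ 2 / δ * n ^ 2 / μ) := by
          field_simp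
        rw [h2] at hk
        have h3 : 0 ≤ 64 * d ^ 2 / δ * n ^ 2 / μ := by positivity
        rw [h1]
        have h4 : 64 * d ^ 2 / δ * ((d + 1) * Real.log 2 + 3) * n ^ 2 / μ =
            ((d + 1) * Real.log 2 + 3) * (64 * d ^ 2 / δ * n ^ 2 / μ) := by ring
        rw [h4]
        linarith

theorem measure_quenchedHitting_ge_le (hδ : 0 < δ) (hp : δ ≤ p) (hμ : 0 < μ) (hμ1 : μ ≤ 1 / 2)
    (hn : 2 ≤ n) {A : Finset (Vertex n d)} (hA : (n : ℝ) ^ d / 2 ≤ A.card) (η₀ : Config n d)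
    {ε : ℝ} (hε : 0 < ε) (hε1 : ε < 1) :
    envNoise n d p μ {ω | ENNReal.ofReal
        (32 * d ^ 2 / δ * (2 * d + 3) * n ^ 2 * Real.log (n / ε) / μ) ≤
          ⨆ x, quenchedHitting A x (environment η₀ ω)} ≤ ENNReal.ofReal ε := by
  classical
  have hd : (1 : ℝ) ≤ d := by exact_mod_cast NeZero.one_le
  have hn0 : (2 : ℝ) ≤ n := by exact_mod_cast hn
  have hprob := isProbabilityMeasure_envNoise n d p hμ
  have hθ := decayRate_pos (d := d) (n := n) hδ hμ
  have hθ1 := decayRate_le_one (d := d) (n := n) hδ hp hμ hμ1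
  have hθinv : (decayRate δ μ d n)⁻¹ = 32 * d ^ 2 / δ * n ^ 2 / μ := by
    rw [decayRate]; field_simp
  set θ := decayRate δ μ d n with hθdef
  set ℓ := Real.log (n / ε) with hℓ
  have hnε : 2 ≤ n / ε := by
    rw [le_div_iff₀ hε]; nlinarith
  have hℓ2 : 1 / 2 ≤ ℓ := by
    calc (1 / 2 : ℝ) ≤ Real.log 2 := by linarith [Real.log_two_gt_d9]
      _ ≤ ℓ := Real.log_le_log two_pos hnε
  -- Chosen so that $(1-\theta/2)^J\le(\varepsilon/n)^{2d}$: one factor $n^d$ pays for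
  -- Cauchy–Schwarz, the other for the union over starting points.
  set J := ⌈4 * d * ℓ / θ⌉₊ with hJ
  have hJ1 : (J : ℝ) ≤ 4 * d * ℓ / θ + 1 := (Nat.ceil_lt_add_one (by positivity)).le
  have hJ2 : 4 * d * ℓ / θ ≤ J := Nat.le_ceil _
  -- the expected mass beyond ring number `J`, summed over all starting points outside of `A`
  let T : (Edge n d → Clock Bool) → ℝ≥0∞ := fun ω =>
    ∑ x ∈ Aᶜ, ∑' j, mass A (environment η₀ ω) x (j + J)
  have hTx (x : Vertex n d) : Measurable fun ω => ∑' j, mass A (environment η₀ ω) x (j + J) :=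
    Measurable.tsum fun j => measurable_mass _ η₀ x (j + J)
  have hT : Measurable T := Finset.measurable_fun_sum _ fun x _ => hTx x
  have hsup (ω : Edge n d → Clock Bool) :
      ⨆ x, quenchedHitting A x (environment η₀ ω) ≤ 2⁻¹ * (J + T ω) := by
    refine iSup_le fun x => ?_
    by_cases hx : x ∈ A
    · rw [quenchedHitting_eq_zero (A : Set (Vertex n d)) _
        (show x ∈ (A : Set (Vertex n d)) from hx)]
      exact bot_le
    refine (quenchedHitting_le (A : Set (Vertex n d)) (measurable_environment_path η₀ ω)
      (by simpa using hx)).trans ?_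
    change 2⁻¹ * ∑' k, mass A (environment η₀ ω) x k ≤ _
    rw [tsum_eq_sum_add_tsum _ J]
    gcongr
    · calc ∑ k ∈ Finset.range J, mass A (environment η₀ ω) x k ≤ ∑ _k ∈ Finset.range J, 1 :=
            Finset.sum_le_sum fun j _ => mass_le_one _ _ _ _
        _ = _ := by simp
    · exact Finset.single_le_sum (f := fun x => ∑' j, mass A (environment η₀ ω) x (j + J))
        (fun _ _ => bot_le) (by simpa using hx)
  have hET : ∫⁻ ω, T ω ∂envNoise n d p μ ≤ ENNReal.ofReal (2 * ε / θ) := by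
    have hexp : (1 - θ / 2) ^ J ≤ (ε / n) ^ (2 * d) := by
      refine (one_sub_pow_le_exp (by linarith) J).trans ?_
      have h1 : (2 * d : ℕ) * ℓ ≤ θ / 2 * J := by
        calc ((2 * d : ℕ) : ℝ) * ℓ = θ / 2 * (4 * d * ℓ / θ) := by
              push_cast; field_simp; norm_num
          _ ≤ _ := by gcongr
      calc Real.exp (-(θ / 2 * J)) ≤ Real.exp (-((2 * d : ℕ) * ℓ)) :=
            Real.exp_le_exp.2 (by linarith)
        _ = _ := by
            rw [Real.exp_neg, Real.exp_nat_mul, hℓ, Real.exp_log (by positivity), ← inv_pow,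
              inv_div]
    have hbound : (n : ℝ) ^ d * ((1 + n ^ d * 1) / 2 * (1 - θ / 2) ^ J) ≤ ε := by
      have hnd : (1 : ℝ) ≤ (n : ℝ) ^ d := one_le_pow₀ (by linarith)
      have h1 : (1 + (n : ℝ) ^ d * 1) / 2 ≤ n ^ d := by linarith
      calc (n : ℝ) ^ d * ((1 + n ^ d * 1) / 2 * (1 - θ / 2) ^ J)
          ≤ n ^ d * (n ^ d * (ε / n) ^ (2 * d)) := by
            have h0 : 0 ≤ (1 - θ / 2) ^ J := pow_nonneg (by linarith) J
            gcongr
        _ = ε ^ (2 * d) := by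
            rw [div_pow, two_mul, pow_add (n : ℝ)]
            field_simp
        _ ≤ ε ^ 1 := pow_le_pow_of_le_one hε.le hε1.le (by have := NeZero.pos d; omega)
        _ = ε := pow_one ε
    calc ∫⁻ ω, T ω ∂envNoise n d p μ
        = ∑ x ∈ Aᶜ, ∑' j, ∫⁻ ω, mass A (environment η₀ ω) x (j + J) ∂envNoise n d p μ := by
          rw [lintegral_finsetSum _ fun x _ => hTx x]
          exact Finset.sum_congr rfl fun x _ =>
            lintegral_tsum fun j => (measurable_mass _ η₀ x (j + J)).aemeasurable
      _ ≤ ∑ _x ∈ (Aᶜ : Finset (Vertex n d)),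
            ENNReal.ofReal ((1 + n ^ d * 1) / 2 * (1 - θ / 2) ^ J * (θ / 2)⁻¹) := by
          refine Finset.sum_le_sum fun x hx => ?_
          have hx' : x ∉ A := by simpa using hx
          have h1 (j : ℕ) : ∫⁻ ω, mass A (environment η₀ ω) x (j + J) ∂envNoise n d p μ ≤
              ENNReal.ofReal ((1 + n ^ d * 1) / 2 * (1 - θ / 2) ^ J) *
                ENNReal.ofReal ((1 - θ / 2) ^ j) := by
            have h := lintegral_mass_add_le hδ hp hμ hμ1 hn hA η₀ hx'
              (meanSq_toReal_le_one (p := p) hμ (A : Set (Vertex n d)) η₀ x 0) (j + J)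
            rw [zero_add] at h
            refine h.trans (le_of_eq ?_)
            rw [← ENNReal.ofReal_mul
              (mul_nonneg (by positivity) (pow_nonneg (by linarith) J)), ← hθdef]
            congr 1
            ring
          refine (ENNReal.tsum_le_tsum h1).trans (le_of_eq ?_)
          rw [ENNReal.tsum_mul_left, tsum_ofReal_geometric (by linarith) (by linarith),
            ← ENNReal.ofReal_mul (mul_nonneg (by positivity) (pow_nonneg (by linarith) J))]
          congr 3
          ring
      _ ≤ (n ^ d : ℕ) * ENNReal.ofReal ((1 + n ^ d * 1) / 2 * (1 - θ / 2) ^ J * (θ / 2)⁻¹) := by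
          rw [Finset.sum_const, nsmul_eq_mul]
          gcongr
          refine (Finset.card_le_univ _).trans (le_of_eq ?_)
          simp [ZMod.card]
      _ ≤ ENNReal.ofReal (2 * ε / θ) := by
          rw [← ENNReal.ofReal_natCast, ← ENNReal.ofReal_mul (by positivity)]
          refine ENNReal.ofReal_le_ofReal ?_
          push_cast
          calc (n : ℝ) ^ d * ((1 + n ^ d * 1) / 2 * (1 - θ / 2) ^ J * (θ / 2)⁻¹)
              = (n : ℝ) ^ d * ((1 + n ^ d * 1) / 2 * (1 - θ / 2) ^ J) * (θ / 2)⁻¹ := by ring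
            _ ≤ ε * (θ / 2)⁻¹ := by gcongr
            _ = _ := by field_simp
  -- Up to ring $J$ the masses are bounded by $1$, so a large supremum forces a large tail. The
  -- constant $2d+3$ absorbs the rounding in $J$ and the tail threshold $2/\theta$, through $\ell\ge
  -- 1/2$ and $\theta\le 1$.
  have hsubset : {ω | ENNReal.ofReal
        (32 * d ^ 2 / δ * (2 * d + 3) * n ^ 2 * ℓ / μ) ≤
          ⨆ x, quenchedHitting A x (environment η₀ ω)} ⊆ {ω | ENNReal.ofReal (2 / θ) ≤ T ω} := by
    intro ω hω
    have h1 : ENNReal.ofReal ((J + 2 / θ) / 2) ≤ 2⁻¹ * (J + T ω) := by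
      refine le_trans (ENNReal.ofReal_le_ofReal ?_) (hω.trans (hsup ω))
      have h2 : 32 * d ^ 2 / δ * (2 * d + 3) * n ^ 2 * ℓ / μ = (2 * d + 3) * ℓ * θ⁻¹ := by
        rw [hθinv]; ring
      have h3 : 1 ≤ θ⁻¹ := (one_le_inv₀ hθ).2 hθ1
      rw [h2]
      have h4 : (J : ℝ) ≤ 4 * d * ℓ * θ⁻¹ + 1 := by rw [← div_eq_mul_inv]; exact hJ1
      have h5 : 1 / 2 * θ⁻¹ ≤ ℓ * θ⁻¹ := by gcongr
      rw [div_eq_mul_inv 2 θ]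
      linarith
    rw [show ((J : ℝ) + 2 / θ) / 2 = 2⁻¹ * (J + 2 / θ) by ring,
      ENNReal.ofReal_mul (by norm_num), ENNReal.ofReal_inv_of_pos two_pos, ENNReal.ofReal_ofNat,
      ENNReal.mul_le_mul_iff_right (by simp) (by simp),
      ENNReal.ofReal_add (by positivity) (by positivity), ENNReal.ofReal_natCast] at h1
    exact (ENNReal.add_le_add_iff_left (by simp)).1 h1
  refine (measure_mono hsubset).trans ?_
  have hmarkov := mul_meas_ge_le_lintegral (μ := envNoise n d p μ) hT (ENNReal.ofReal (2 / θ))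
  have h2 : ENNReal.ofReal (2 * ε / θ) = ENNReal.ofReal (2 / θ) * ENNReal.ofReal ε := by
    rw [← ENNReal.ofReal_mul (by positivity)]; congr 1; ring
  have h3 := hmarkov.trans (hET.trans_eq h2)
  rwa [ENNReal.mul_le_mul_iff_right (by simpa using by positivity) ENNReal.ofReal_ne_top] at h3

theorem quenchedHitting_torus_one {A : Finset (Vertex 1 d)} (hA : ((1 : ℕ) : ℝ) ^ d / 2 ≤ A.card)
    (x : Vertex 1 d) (η : ℝ≥0 → Config 1 d) : quenchedHitting A x η = 0 := by
  refine quenchedHitting_eq_zero _ _ ?_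
  have hpos : 0 < A.card := by
    rw [← Nat.cast_pos (α := ℝ)]
    norm_num at hA
    linarith
  obtain ⟨y, hy⟩ := Finset.card_pos.1 hpos
  rwa [Subsingleton.elim x y]

end Hitting

end DynamicalPercolation

/-! ### The theorem, with the degenerate cases -/

theorem theorem1p3 (d : ℕ) [NeZero d] (δ : ℝ) (hδ : 0 < δ) :
    ∃ C : ℝ, 0 < C ∧
      ∀ (p : unitInterval), δ ≤ (p : ℝ) →
      ∀ (n : ℕ), 1 ≤ n →
      ∀ (μ : ℝ), 0 < μ → μ ≤ 1 / 2 →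
      ∀ (A : Finset (DynamicalPercolation.Vertex n d)), (n : ℝ) ^ d / 2 ≤ (A.card : ℝ) →
        (∀ (ε : ℝ), 0 < ε → ∀ (η₀ : DynamicalPercolation.Config n d),
          DynamicalPercolation.envNoise n d p μ
            {ω | ENNReal.ofReal (C * (n : ℝ) ^ 2 * Real.log ((n : ℝ) / ε) / μ) ≤
              ⨆ x : DynamicalPercolation.Vertex n d,
                DynamicalPercolation.quenchedHitting (A : Set (DynamicalPercolation.Vertex n d)) x
                  (DynamicalPercolation.environment η₀ ω)} ≤ ENNReal.ofReal ε) ∧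
        (∀ (x : DynamicalPercolation.Vertex n d) (η₀ : DynamicalPercolation.Config n d),
          DynamicalPercolation.annealedHitting p μ
              (A : Set (DynamicalPercolation.Vertex n d)) x η₀ ≤
            ENNReal.ofReal (C * (n : ℝ) ^ 2 / μ)) := by
  have hd : (0 : ℝ) < d := by exact_mod_cast NeZero.pos d
  set C₁ : ℝ := 32 * d ^ 2 / δ * (2 * d + 3) with hC₁
  set C₂ : ℝ := 64 * d ^ 2 / δ * ((d + 1) * Real.log 2 + 3) with hC₂
  have hC₁0 : 0 < C₁ := by positivity
  have hC₂0 : 0 < C₂ := by positivity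
  refine ⟨C₁ + C₂, by positivity, fun p hp n hn μ hμ hμ1 A hA => ?_⟩
  have hn0 : (1 : ℝ) ≤ n := by exact_mod_cast hn
  have hprob := DynamicalPercolation.isProbabilityMeasure_envNoise n d p hμ
  constructor
  · intro ε hε η₀
    rcases le_or_gt 1 ε with hε1 | hε1
    · refine prob_le_one.trans ?_
      rw [← ENNReal.ofReal_one]
      exact ENNReal.ofReal_le_ofReal hε1
    have hlog : 0 < Real.log (n / ε) := Real.log_pos (by rw [lt_div_iff₀ hε]; linarith)
    rcases hn.lt_or_eq with hn2 | rfl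
    · have : NeZero n := ⟨by omega⟩
      refine (measure_mono fun ω hω => ?_).trans
        (DynamicalPercolation.measure_quenchedHitting_ge_le hδ hp hμ hμ1 hn2 hA η₀ hε hε1)
      refine le_trans (ENNReal.ofReal_le_ofReal ?_) hω
      gcongr
      linarith
    -- For $n=1$ the torus is a single vertex, which lies in $A$. The threshold is positive because
    -- $\varepsilon<1$, so the event is empty.
    · simp_rw [DynamicalPercolation.quenchedHitting_torus_one hA]
      have : 0 < (C₁ + C₂) * ((1 : ℕ) : ℝ) ^ 2 * Real.log (((1 : ℕ) : ℝ) / ε) / μ := by positivity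
      simp [-Nat.cast_one, this.not_ge]
  · intro x η₀
    have : NeZero n := ⟨by omega⟩
    rcases hn.lt_or_eq with hn2 | rfl
    · refine (DynamicalPercolation.annealedHitting_le hδ hp hμ hμ1 hn2 hA η₀ x).trans
        (ENNReal.ofReal_le_ofReal ?_)
      gcongr
      linarith
    · refine (DynamicalPercolation.annealedHitting_le_lintegral hμ _ η₀ x).trans ?_
      simp [DynamicalPercolation.quenchedHitting_torus_one hA]
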